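/- **Setting.** Let $\mathbb M$ be a connected, non-compact $C^\infty$ manifold (Hausdorff, second countable) with a smooth measure $\mu$, i.e. a measure with a smooth strictly positive density with respect to Lebesgue measure in every chart. Let $L$ be a second-order diffusion operator on $\mathbb M$ with real smooth coefficients (in charts $L=\sum a_{ij}\partial_i\partial_j+\sum b_i\partial_i+c$ with $(a_{ij})$ symmetric positive semidefinite). Assume that $L$ is locally subelliptic: every point has a neighbourhood $U$ inside a chart and constants $\varepsilon>0$, $C$ such that $\|u\|_{H^\varepsilon}^2\le C\left(\left|\int uLu\,d\mu\right|+\int u^2\,d\mu\right)$ for all $u\in C_0^\infty(U)$. Assume also that $L1=0$, and that $\int fLg\,d\mu=\int gLf\,d\mu$ and $\int fLf\,d\mu\le 0$ for $f,g\in C_0^\infty(\mathbb M)$. Put $$\Gamma(f,g)=\tfrac12\big(L(fg)-fLg-gLf\big),\qquad \Gamma(f)=\Gamma(f,f),$$ $$d(x,y)=\sup\{|f(x)-f(y)| : f\in C^\infty(\mathbb M),\ \|\Gamma(f)\|_\infty\le 1\},\qquad d(E,F)=\inf_{x\in E,\,y\in F}d(x,y).$$ Assume that any two points of $\mathbb M$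 are joined by a subunit path for $L$ (a Lipschitz path $\gamma:[0,T]\to\mathbb M$ with $\big((f\circ\gamma)'(t)\big)^2\le\Gamma(f)(\gamma(t))$ for a.e. $t$ and all $f\in C^\infty(\mathbb M)$), so that $d$ is finite, and that $(\mathbb M,d)$ is complete. Let $\Gamma^Z$ be a bilinear form $C^\infty(\mathbb M)\times C^\infty(\mathbb M)\to C^\infty(\mathbb M)$ with $\Gamma^Z(fg,h)=f\Gamma^Z(g,h)+g\Gamma^Z(f,h)$ and $\Gamma^Z(f)=\Gamma^Z(f,f)\ge0$, such that the following hold. * (H.1) There is an increasing sequence $h_k\in C_0^\infty(\mathbb M)$ with $h_k\nearrow1$ and $\|\Gamma(h_k)\|_\infty+\|\Gamma^Z(h_k)\|_\infty\to0$. * (H.2) $\Gamma(f,\Gamma^Z(f))=\Gamma^Z(f,\Gamma(f))$ for all $f\in C^\infty(\mathbb M)$. * (H.3) There are constants $\rho_1\ge0$, $\rho_2>0$, $\kappa\ge0$, $D\ge2$ such that for all $f\in C^\infty(\mathbb M)$ and $\nu>0$ $$\Gamma_2(f)+\nu\Gamma_2^Z(f)\ge\tfrac1D(Lf)^2+\left(\rho_1-\tfrac{\kappa}{\nu}\right)\Gamma(f)+\rho_2\Gamma^Z(f),$$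 where $\Gamma_2(f)=\tfrac12\big(L\Gamma(f)-2\Gamma(f,Lf)\big)$ and $\Gamma^Z_2(f)=\tfrac12\big(L\Gamma^Z(f)-\Gamma^Z(f,Lf)-\Gamma^Z(f,Lf)\big)$. Let $(P_t)_{t\ge0}$, $P_t=e^{tL}$, be the heat semigroup: the strongly continuous contraction semigroup on $L^2(\mathbb M,\mu)$ whose infinitesimal generator is the Friedrichs extension of $L|_{C_0^\infty(\mathbb M)}$. It acts on $L^\infty(\mathbb M)$ as the adjoint of its extension to $L^1(\mathbb M)$, and the two actions agree on $L^2\cap L^\infty$. **Lemma.** For every two closed sets $E,F\subset\mathbb M$, every $t>0$ and every $f\in L^\infty(\mathbb M)$ supported in $E$ (i.e. $f=0$ a.e. outside $E$), $$\|P_tf\|_{L^2(F)}\le e^{-\frac{d(E,F)^2}{4t}}\,\|f\|_{L^2(E)},$$ where norms take values in $[0,\infty]$. (If $E$ or $F$ is empty, the left side is $0$ and the estimate is trivial.) -/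

import Mathlib

open MeasureTheory Filter Topology Set
open scoped Manifold ContDiff ENNReal FourierTransform

/-- The algebra `C^∞(M)` of real-valued smooth functions on an `n`-dimensional manifold `M`. -/
abbrev SmoothFn (n : ℕ) (M : Type*) [TopologicalSpace M]
    [ChartedSpace (EuclideanSpace ℝ (Fin n)) M] : Type _ :=
  C^∞⟮𝓡 n, M; ℝ⟯

/-- A smooth measure: in every chart of the atlas it has a smooth, strictly positive density
with respect to Lebesgue measure. -/
def IsSmoothMeasure (n : ℕ) {M : Type*} [TopologicalSpace M]
    [ChartedSpace (EuclideanSpace ℝ (Fin n)) M] [MeasurableSpace M] (μ : Measure M) : Prop :=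
  ∀ e ∈ atlas (EuclideanSpace ℝ (Fin n)) M, ∃ ρ : EuclideanSpace ℝ (Fin n) → ℝ,
    ContDiffOn ℝ ∞ ρ e.target ∧ (∀ y ∈ e.target, 0 < ρ y) ∧
    (μ.restrict e.source).map e =
      (volume.restrict e.target).withDensity (fun y => ENNReal.ofReal (ρ y))

/-- The `i`-th partial derivative of a function on `ℝⁿ`. -/
noncomputable def partialD {n : ℕ} (i : Fin n) (g : EuclideanSpace ℝ (Fin n) → ℝ)
    (y : EuclideanSpace ℝ (Fin n)) : ℝ :=
  fderiv ℝ g y (EuclideanSpace.single i 1)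

/-- A second-order diffusion operator with real (smooth) coefficients: in every chart
`L f = ∑ aᵢⱼ ∂ᵢ∂ⱼ f + ∑ bᵢ ∂ᵢ f + c f` with smooth `aᵢⱼ`, `bᵢ`, `c` and a symmetric positive
semidefinite matrix `(aᵢⱼ)`. -/
def IsDiffusionOperator {n : ℕ} {M : Type*} [TopologicalSpace M]
    [ChartedSpace (EuclideanSpace ℝ (Fin n)) M]
    (L : SmoothFn n M →ₗ[ℝ] SmoothFn n M) : Prop :=
  ∀ e ∈ atlas (EuclideanSpace ℝ (Fin n)) M,
    ∃ (a : Fin n → Fin n → EuclideanSpace ℝ (Fin n) → ℝ)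
      (b : Fin n → EuclideanSpace ℝ (Fin n) → ℝ) (c : EuclideanSpace ℝ (Fin n) → ℝ),
      (∀ i j, ContDiffOn ℝ ∞ (a i j) e.target) ∧ (∀ i, ContDiffOn ℝ ∞ (b i) e.target) ∧
      ContDiffOn ℝ ∞ c e.target ∧
      (∀ y ∈ e.target, (Matrix.of fun i j => a i j y).PosSemidef) ∧
      ∀ (f : SmoothFn n M), ∀ x ∈ e.source,
        L f x = ∑ i, ∑ j, a i j (e x) * partialD i (partialD j (f ∘ e.symm)) (e x)
          + ∑ i, b i (e x) * partialD i (f ∘ e.symm) (e x) + c (e x) * f x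

/-- The square of the norm of the Sobolev space `H^s(ℝⁿ)`, as `∫ (1 + |ξ|²)^s |v̂(ξ)|² dξ`. -/
noncomputable def sobolevNormSq {n : ℕ} (s : ℝ) (v : EuclideanSpace ℝ (Fin n) → ℂ) : ℝ≥0∞ :=
  ∫⁻ ξ, ENNReal.ofReal ((1 + ‖ξ‖ ^ 2) ^ s * ‖𝓕 v ξ‖ ^ 2)

/-- Local subellipticity: every point has a neighbourhood `U` inside a chart, and
constants `ε > 0`, `C`, with `‖u‖²_{H^ε} ≤ C (|∫ u L u dμ| + ∫ u² dμ)` for all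
`u ∈ C₀^∞(U)`; the Sobolev norm is that of `u` read in the chart and extended by zero. -/
def IsLocallySubelliptic {n : ℕ} {M : Type*} [TopologicalSpace M]
    [ChartedSpace (EuclideanSpace ℝ (Fin n)) M] [MeasurableSpace M] (μ : Measure M)
    (L : SmoothFn n M →ₗ[ℝ] SmoothFn n M) : Prop :=
  ∀ x : M, ∃ e ∈ atlas (EuclideanSpace ℝ (Fin n)) M, ∃ U : Set M,
    IsOpen U ∧ x ∈ U ∧ U ⊆ e.source ∧
    ∃ (ε : ℝ) (C : ℝ), 0 < ε ∧ ∀ u : SmoothFn n M, HasCompactSupport u → tsupport u ⊆ U →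
      sobolevNormSq ε (e.target.indicator fun y => ((u (e.symm y) : ℝ) : ℂ)) ≤
        ENNReal.ofReal (C * (|∫ z, u z * L u z ∂μ| + ∫ z, u z ^ 2 ∂μ))

/-- The carré du champ `Γ(f,g) = ½ (L(fg) - f L g - g L f)`. -/
noncomputable def carreDuChamp {n : ℕ} {M : Type*} [TopologicalSpace M]
    [ChartedSpace (EuclideanSpace ℝ (Fin n)) M]
    (L : SmoothFn n M →ₗ[ℝ] SmoothFn n M) (f g : SmoothFn n M) : SmoothFn n M :=
  (1 / 2 : ℝ) • (L (f * g) - f * L g - g * L f)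

/-- For a form `G` on `C^∞(M)`, the second-order form
`G₂(f,g) = ½ (L G(f,g) - G(f, L g) - G(g, L f))`. -/
noncomputable def iteratedForm {n : ℕ} {M : Type*} [TopologicalSpace M]
    [ChartedSpace (EuclideanSpace ℝ (Fin n)) M]
    (L : SmoothFn n M →ₗ[ℝ] SmoothFn n M)
    (G : SmoothFn n M → SmoothFn n M → SmoothFn n M) (f g : SmoothFn n M) : SmoothFn n M :=
  (1 / 2 : ℝ) • (L (G f g) - G f (L g) - G g (L f))

/-- The canonical distance `d(x,y) = sup {|f x - f y| : f ∈ C^∞(M), ‖Γ(f)‖_∞ ≤ 1}`, as an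
extended nonnegative number (it is finite once all points are joined by subunit paths). -/
noncomputable def canonicalDist {n : ℕ} {M : Type*} [TopologicalSpace M]
    [ChartedSpace (EuclideanSpace ℝ (Fin n)) M] [MeasurableSpace M] (μ : Measure M)
    (L : SmoothFn n M →ₗ[ℝ] SmoothFn n M) (x y : M) : ℝ≥0∞ :=
  ⨆ (f : SmoothFn n M) (_ : ∀ᵐ z ∂μ, |carreDuChamp L f f z| ≤ 1), ENNReal.ofReal |f x - f y|

/-- The distance `d(E,F) = inf {d(x,y) : x ∈ E, y ∈ F}` between two sets. -/
noncomputable def setDist {n : ℕ} {M : Type*} [TopologicalSpace M]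
    [ChartedSpace (EuclideanSpace ℝ (Fin n)) M] [MeasurableSpace M] (μ : Measure M)
    (L : SmoothFn n M →ₗ[ℝ] SmoothFn n M) (E F : Set M) : ℝ≥0∞ :=
  ⨅ (x ∈ E) (y ∈ F), canonicalDist μ L x y

/-- `(M, d)` is complete: every `d`-Cauchy sequence has a `d`-limit. -/
def IsCompleteForCanonicalDist {n : ℕ} {M : Type*} [TopologicalSpace M]
    [ChartedSpace (EuclideanSpace ℝ (Fin n)) M] [MeasurableSpace M] (μ : Measure M)
    (L : SmoothFn n M →ₗ[ℝ] SmoothFn n M) : Prop :=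
  ∀ s : ℕ → M,
    (∀ ε : ℝ≥0∞, 0 < ε → ∃ N, ∀ j ≥ N, ∀ k ≥ N, canonicalDist μ L (s j) (s k) < ε) →
      ∃ x, Tendsto (fun k => canonicalDist μ L (s k) x) atTop (𝓝 0)

/-- `γ : [0,T] → M` is a subunit path for `L`: it is Lipschitz (read through smooth functions on
`M`, which contain local coordinates multiplied by cutoffs) and for almost every `t` it is
differentiable with velocity `v` satisfying `(v f)² ≤ Γ(f)(γ t)` for all smooth `f`. If
`Γ(f) = ∑ (Xᵢ f)²` near the point, the last condition says that `v = ∑ aᵢ Xᵢ` for some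
`a` with `∑ aᵢ² ≤ 1`. -/
def IsSubunitPath {n : ℕ} {M : Type*} [TopologicalSpace M]
    [ChartedSpace (EuclideanSpace ℝ (Fin n)) M]
    (L : SmoothFn n M →ₗ[ℝ] SmoothFn n M) (T : ℝ) (γ : ℝ → M) : Prop :=
  ContinuousOn γ (Icc 0 T) ∧
  (∀ f : SmoothFn n M, ∃ K, LipschitzOnWith K (fun t => f (γ t)) (Icc 0 T)) ∧
  ∀ᵐ t ∂(volume.restrict (Ioo 0 T)), ∀ f : SmoothFn n M, ∃ v : ℝ,
    HasDerivAt (fun s => f (γ s)) v t ∧ v ^ 2 ≤ carreDuChamp L f f (γ t)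

/-- Any two points are joined by a subunit path. -/
def SubunitConnected {n : ℕ} {M : Type*} [TopologicalSpace M]
    [ChartedSpace (EuclideanSpace ℝ (Fin n)) M]
    (L : SmoothFn n M →ₗ[ℝ] SmoothFn n M) : Prop :=
  ∀ x y : M, ∃ T : ℝ, 0 ≤ T ∧ ∃ γ : ℝ → M, IsSubunitPath L T γ ∧ γ 0 = x ∧ γ T = y

/-- Standing assumptions on the operator `L` and the measure `μ`. -/
structure IsSubRiemannianOperator {n : ℕ} {M : Type*} [TopologicalSpace M]
    [ChartedSpace (EuclideanSpace ℝ (Fin n)) M] [MeasurableSpace M] (μ : Measure M)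
    (L : SmoothFn n M →ₗ[ℝ] SmoothFn n M) : Prop where
  diffusion : IsDiffusionOperator L
  subelliptic : IsLocallySubelliptic μ L
  map_one : L 1 = 0
  symm : ∀ f g : SmoothFn n M, HasCompactSupport f → HasCompactSupport g →
    ∫ x, f x * L g x ∂μ = ∫ x, g x * L f x ∂μ
  nonpos : ∀ f : SmoothFn n M, HasCompactSupport f → ∫ x, f x * L f x ∂μ ≤ 0
  subunitConnected : SubunitConnected L
  complete : IsCompleteForCanonicalDist μ L

/-- The hypotheses on a second bilinear form `Γ^Z`: the derivation property, nonnegativity, and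
the assumptions (H.1), (H.2) and (H.3), the last being the generalized curvature-dimension
inequality `CD(ρ₁, ρ₂, κ, d)` with `ρ₁ ≥ 0`. -/
structure IsVerticalForm {n : ℕ} {M : Type*} [TopologicalSpace M]
    [ChartedSpace (EuclideanSpace ℝ (Fin n)) M] [MeasurableSpace M] (μ : Measure M)
    (L : SmoothFn n M →ₗ[ℝ] SmoothFn n M)
    (ΓZ : SmoothFn n M →ₗ[ℝ] SmoothFn n M →ₗ[ℝ] SmoothFn n M) : Prop where
  leibniz : ∀ f g h : SmoothFn n M, ΓZ (f * g) h = f * ΓZ g h + g * ΓZ f h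
  nonneg : ∀ (f : SmoothFn n M) (x : M), 0 ≤ ΓZ f f x
  exists_cutoff : ∃ h : ℕ → SmoothFn n M,
    (∀ k, HasCompactSupport (h k)) ∧ (∀ x, Monotone fun k => h k x) ∧
    (∀ x, Tendsto (fun k => h k x) atTop (𝓝 1)) ∧
    Tendsto (fun k => eLpNorm (carreDuChamp L (h k) (h k)) ∞ μ + eLpNorm (ΓZ (h k) (h k)) ∞ μ)
      atTop (𝓝 0)
  commute : ∀ f : SmoothFn n M, carreDuChamp L f (ΓZ f f) = ΓZ f (carreDuChamp L f f)
  curvatureDimension : ∃ ρ₁ ρ₂ κ d : ℝ, 0 ≤ ρ₁ ∧ 0 < ρ₂ ∧ 0 ≤ κ ∧ 2 ≤ d ∧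
    ∀ (f : SmoothFn n M) (ν : ℝ), 0 < ν → ∀ x : M,
      (1 / d) * (L f x) ^ 2 + (ρ₁ - κ / ν) * carreDuChamp L f f x + ρ₂ * ΓZ f f x ≤
        iteratedForm L (carreDuChamp L) f f x + ν * iteratedForm L (fun f g => ΓZ f g) f f x

/-- The graph of the Friedrichs extension of `L` (with initial domain `C₀^∞(M)`) in `L²(M,μ)`.
It is the restriction of the adjoint of `L|_{C₀^∞(M)}` to the form domain: `u` is in the domain
with value `g` iff `⟨u, L φ⟩ = ⟨g, φ⟩` for all `φ ∈ C₀^∞(M)`, and `u` is the `L²`-limit of a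
sequence in `C₀^∞(M)` that is Cauchy for the energy `w ↦ -∫ w L w dμ`. -/
def FriedrichsGraph {n : ℕ} {M : Type*} [TopologicalSpace M]
    [ChartedSpace (EuclideanSpace ℝ (Fin n)) M] [MeasurableSpace M] (μ : Measure M)
    (L : SmoothFn n M →ₗ[ℝ] SmoothFn n M) (u g : Lp ℝ 2 μ) : Prop :=
  (∀ φ : SmoothFn n M, HasCompactSupport φ → ∫ x, u x * L φ x ∂μ = ∫ x, g x * φ x ∂μ) ∧
  ∃ φ : ℕ → SmoothFn n M, (∀ k, HasCompactSupport (φ k)) ∧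
    Tendsto (fun k => eLpNorm (fun x => φ k x - u x) 2 μ) atTop (𝓝 0) ∧
    ∀ ε : ℝ, 0 < ε → ∃ N, ∀ j ≥ N, ∀ k ≥ N,
      -∫ x, (φ j - φ k) x * L (φ j - φ k) x ∂μ < ε

/-- `(P t)_{t ≥ 0}` is the heat semigroup `e^{tL}` on `L²(M,μ)`: the strongly continuous
contraction semigroup whose infinitesimal generator is the Friedrichs extension of `L`.
A strongly continuous semigroup is determined by its generator, so there is only one such
family on `[0,∞)`; the values at `t < 0` play no role. -/
structure IsHeatSemigroup {n : ℕ} {M : Type*} [TopologicalSpace M]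
    [ChartedSpace (EuclideanSpace ℝ (Fin n)) M] [MeasurableSpace M] (μ : Measure M)
    (L : SmoothFn n M →ₗ[ℝ] SmoothFn n M) (P : ℝ → (Lp ℝ 2 μ →L[ℝ] Lp ℝ 2 μ)) : Prop where
  zero : P 0 = ContinuousLinearMap.id ℝ (Lp ℝ 2 μ)
  add : ∀ s t : ℝ, 0 ≤ s → 0 ≤ t → P (s + t) = (P s).comp (P t)
  contraction : ∀ (t : ℝ), 0 ≤ t → ∀ f : Lp ℝ 2 μ, ‖P t f‖ ≤ ‖f‖
  continuous : ∀ f : Lp ℝ 2 μ, ContinuousOn (fun t => P t f) (Ici 0)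
  generator : ∀ u g : Lp ℝ 2 μ,
    Tendsto (fun h : ℝ => h⁻¹ • (P h u - u)) (𝓝[>] 0) (𝓝 g) ↔ FriedrichsGraph μ L u g

/-- `u = P_t f` for a function `f` in `L²` or in `L^∞`. On `L²` this is the operator `P t`; on
`L^∞` it is the adjoint of the extension of `P t` to `L¹`, that is, `u ∈ L^∞` and
`∫ u g dμ = ∫ f P_t g dμ` for all `g ∈ L¹ ∩ L²`. The two agree on `L² ∩ L^∞`. -/
def IsHeatEvolution {M : Type*} [MeasurableSpace M] (μ : Measure M)
    (P : ℝ → (Lp ℝ 2 μ →L[ℝ] Lp ℝ 2 μ)) (t : ℝ) (f u : M → ℝ) : Prop :=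
  (∃ hf : MemLp f 2 μ, u =ᵐ[μ] P t (hf.toLp f)) ∨
  (MemLp f ∞ μ ∧ MemLp u ∞ μ ∧
    ∀ (g : M → ℝ) (hg : MemLp g 2 μ), Integrable g μ →
      ∫ x, u x * g x ∂μ = ∫ x, f x * P t (hg.toLp g) x ∂μ)

/-! ### Product and chain rules for coordinate partial derivatives. -/

section PartialDerivatives

variable {n : ℕ} {i j : Fin n} {F G : EuclideanSpace ℝ (Fin n) → ℝ}
  {y : EuclideanSpace ℝ (Fin n)}

/-! The proof is Davies' exponential weight method. Let `ψ` be smooth and bounded with `Γ(ψ) ≤ 1`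
almost everywhere, `ψ ≤ 0` on `E` and `ψ ≥ r` on `F`, and put `φ = exp(aψ)`, so that `Γ(φ) ≤ a²φ²`.
For `u_t = P_t u`, integration by parts and completing the square give `d/dt ∫ φ² u_t² = -2 ∫ Γ(u_t,
φ² u_t) ≤ 2 ∫ u_t² Γ(φ) ≤ 2a² ∫ φ² u_t²`. By Gronwall, if `u` lives on `E`, then `e^{2ar}
‖u_t‖²_{L²(F)} ≤ e^{2a²t} ‖u‖²`; the choice `a = r/(2t)` and a square root give the factor
`e^{-r²/(4t)}`.

Two points need care. First, `u_t` lies only in the domain of the Friedrichs extension, so the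
integration by parts is carried out on compactly supported approximants that converge in `L²` and
are Cauchy in energy (`inner_mulLp_le_of_friedrichsGraph`); Gronwall then holds on the domain and
passes to `L²` by density (`inner_semigroup_le`).

Second, `d` is a supremum over smooth functions, and one such function must separate two sets at
once. Distance functions and maxima are not smooth, but `s⁻¹ log(e^{sf} + e^{sg})` is, stays close
to `max f g`, and keeps the gradient bound, its gradient being a convex combination of those of `f`
and `g` (`exists_smooth_max`). Finitely many such operations separate compact sets
(`exists_hasUnitGradient_separating`). Closed sets are exhausted by compact ones, which only
increases the distance. Bounded data evolved by the adjoint are reached by duality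
(`eLpNorm_indicator_le_of_adjoint`). -/

theorem Filter.EventuallyEq.partialD (h : F =ᶠ[𝓝 y] G) : partialD i F =ᶠ[𝓝 y] partialD i G := by
  filter_upwards [h.fderiv (𝕜 := ℝ)] with z hz
  simp only [_root_.partialD, hz]

theorem partialD_mul (hF : DifferentiableAt ℝ F y) (hG : DifferentiableAt ℝ G y) :
    partialD i (F * G) y = F y * partialD i G y + G y * partialD i F y := by
  simp [partialD, fderiv_mul hF hG]

theorem partialD_add (hF : DifferentiableAt ℝ F y) (hG : DifferentiableAt ℝ G y) :
    partialD i (F + G) y = partialD i F y + partialD i G y := by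
  simp [partialD, fderiv_add hF hG]

theorem partialD_comp {φ : ℝ → ℝ} {c : ℝ} (hφ : HasDerivAt φ c (F y))
    (hF : DifferentiableAt ℝ F y) : partialD i (φ ∘ F) y = c * partialD i F y := by
  simp [partialD, (hφ.comp_hasFDerivAt y hF.hasFDerivAt).fderiv]

theorem ContDiffAt.partialD (hF : ContDiffAt ℝ ∞ F y) : ContDiffAt ℝ ∞ (partialD i F) y :=
  (hF.fderiv_right (m := ∞) (by simp)).clm_apply contDiffAt_const

theorem partialD_partialD_mul (hF : ContDiffAt ℝ ∞ F y) (hG : ContDiffAt ℝ ∞ G y) :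
    partialD i (partialD j (F * G)) y =
      F y * partialD i (partialD j G) y + G y * partialD i (partialD j F) y +
        (partialD i F y * partialD j G y + partialD i G y * partialD j F y) := by
  have hd {K : EuclideanSpace ℝ (Fin n) → ℝ} (hK : ContDiffAt ℝ ∞ K y) : DifferentiableAt ℝ K y :=
    hK.differentiableAt (by simp)
  have he {K : EuclideanSpace ℝ (Fin n) → ℝ} (hK : ContDiffAt ℝ ∞ K y) :
      ∀ᶠ z in 𝓝 y, DifferentiableAt ℝ K z :=
    ((hK.of_le (m := 1) (by norm_cast)).eventually (by simp)).mono
      fun z hz => hz.differentiableAt (by simp)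
  have h : _root_.partialD j (F * G) =ᶠ[𝓝 y] F * _root_.partialD j G + G * _root_.partialD j F := by
    filter_upwards [he hF, he hG] with z hz hz'
    simp [partialD_mul hz hz']
  rw [(h.partialD (i := i)).self_of_nhds, partialD_add ((hd hF).mul (hd hG.partialD))
    ((hd hG).mul (hd hF.partialD)), partialD_mul (hd hF) (hd hG.partialD),
    partialD_mul (hd hG) (hd hF.partialD)]
  ring

end PartialDerivatives

/-! ### Pointwise calculus of the carré du champ: locality, positivity, Leibniz and chain rules. -/

section LocalCalculus

variable {n : ℕ} {M : Type*} [TopologicalSpace M] [ChartedSpace (EuclideanSpace ℝ (Fin n)) M]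
  {L : SmoothFn n M →ₗ[ℝ] SmoothFn n M}

theorem IsDiffusionOperator.apply_congr (hL : IsDiffusionOperator L) {f g : SmoothFn n M} {x : M}
    (h : f =ᶠ[𝓝 x] g) : L f x = L g x := by
  obtain ⟨a, b, c, -, -, -, -, hf⟩ := hL _ (chart_mem_atlas (EuclideanSpace ℝ (Fin n)) x)
  have hx := mem_chart_source (EuclideanSpace ℝ (Fin n)) x
  set e := chartAt (EuclideanSpace ℝ (Fin n)) x
  have h1 : f ∘ e.symm =ᶠ[𝓝 (e x)] g ∘ e.symm := by
    have ht := e.continuousAt_symm (e.map_source hx)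
    rw [ContinuousAt, e.left_inv hx] at ht
    exact ht.eventually h
  rw [hf f x hx, hf g x hx, h.self_of_nhds]
  simp only [(h1.partialD).self_of_nhds, (h1.partialD.partialD).self_of_nhds]

theorem carreDuChamp_comm (f g : SmoothFn n M) : carreDuChamp L f g = carreDuChamp L g f := by
  simp only [carreDuChamp, mul_comm f g, sub_right_comm]

theorem carreDuChamp_add_left (f g h : SmoothFn n M) :
    carreDuChamp L (f + g) h = carreDuChamp L f h + carreDuChamp L g h := by
  simp only [carreDuChamp, add_mul, mul_add, map_add, ← smul_add]
  congr 1
  ring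

theorem carreDuChamp_smul_left (c : ℝ) (f h : SmoothFn n M) :
    carreDuChamp L (c • f) h = c • carreDuChamp L f h := by
  simp only [carreDuChamp, smul_mul_assoc, mul_smul_comm, map_smul, ← smul_sub]
  rw [smul_comm]

theorem carreDuChamp_add_right (f g h : SmoothFn n M) :
    carreDuChamp L h (f + g) = carreDuChamp L h f + carreDuChamp L h g := by
  simp only [carreDuChamp_comm h, carreDuChamp_add_left]

theorem carreDuChamp_smul_right (c : ℝ) (f h : SmoothFn n M) :
    carreDuChamp L h (c • f) = c • carreDuChamp L h f := by
  simp only [carreDuChamp_comm h, carreDuChamp_smul_left]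

theorem carreDuChamp_const_left (h1 : L 1 = 0) (c : ℝ) (h : SmoothFn n M) :
    carreDuChamp L (c • (1 : SmoothFn n M)) h = 0 := by
  rw [carreDuChamp_smul_left]
  simp [carreDuChamp, h1]

variable [IsManifold (𝓡 n) ∞ M]

theorem SmoothFn.contDiffAt_comp_symm (f : SmoothFn n M)
    {e : OpenPartialHomeomorph M (EuclideanSpace ℝ (Fin n))}
    (he : e ∈ atlas (EuclideanSpace ℝ (Fin n)) M) {x : M} (hx : x ∈ e.source) :
    ContDiffAt ℝ ∞ (f ∘ e.symm) (e x) := by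
  have h := contMDiffOn_symm_of_mem_maximalAtlas (I := 𝓡 n) (n := ∞)
    (IsManifold.subset_maximalAtlas he)
  exact (f.contMDiff.contMDiffAt.comp _
    (h.contMDiffAt (e.open_target.mem_nhds (e.map_source hx)))).contDiffAt

namespace IsDiffusionOperator

/-- In `L(fg) - f Lg - g Lf` the first-order terms cancel, and evaluating `L 1 = 0` in the chart
kills the zeroth-order coefficient. Only the products of first derivatives survive, so `Γ` is a
positive semidefinite first-order form at each point; positivity and the derivation rules all follow
from this. -/
theorem carreDuChamp_apply (hL : IsDiffusionOperator L) (h1 : L 1 = 0) (x : M) :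
    ∃ a : Matrix (Fin n) (Fin n) ℝ, a.PosSemidef ∧ ∀ f g : SmoothFn n M,
      carreDuChamp L f g x = ∑ i, ∑ j, a i j *
        ((partialD i (f ∘ (chartAt (EuclideanSpace ℝ (Fin n)) x).symm)
            (chartAt (EuclideanSpace ℝ (Fin n)) x x) *
          partialD j (g ∘ (chartAt (EuclideanSpace ℝ (Fin n)) x).symm)
            (chartAt (EuclideanSpace ℝ (Fin n)) x x) +
          partialD i (g ∘ (chartAt (EuclideanSpace ℝ (Fin n)) x).symm)
            (chartAt (EuclideanSpace ℝ (Fin n)) x x) *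
          partialD j (f ∘ (chartAt (EuclideanSpace ℝ (Fin n)) x).symm)
            (chartAt (EuclideanSpace ℝ (Fin n)) x x)) / 2) := by
  have he := chart_mem_atlas (EuclideanSpace ℝ (Fin n)) x
  obtain ⟨a, b, c, -, -, -, ha, hf⟩ := hL _ he
  have hx := mem_chart_source (EuclideanSpace ℝ (Fin n)) x
  set e := chartAt (EuclideanSpace ℝ (Fin n)) x
  refine ⟨_, ha (e x) (e.map_source hx), fun f g => ?_⟩
  have hc : c (e x) = 0 := by
    have h2 := hf 1 x hx
    have h3 : ((1 : SmoothFn n M) : M → ℝ) ∘ e.symm = 1 := by ext; simp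
    have h4 (i : Fin n) : partialD i (1 : EuclideanSpace ℝ (Fin n) → ℝ) = 0 := by
      ext; simp [partialD]
    have h5 (i : Fin n) : partialD i (0 : EuclideanSpace ℝ (Fin n) → ℝ) = 0 := by
      ext; simp [partialD]
    simpa [h1, h3, h4, h5] using h2.symm
  have hF := f.contDiffAt_comp_symm he hx
  have hG := g.contDiffAt_comp_symm he hx
  have hFG : ((f * g : SmoothFn n M) : M → ℝ) ∘ e.symm = (f ∘ e.symm) * (g ∘ e.symm) := by
    ext; simp
  have hFx : (f ∘ e.symm) (e x) = f x := by simp [e.left_inv hx]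
  have hGx : (g ∘ e.symm) (e x) = g x := by simp [e.left_inv hx]
  have hd {K : EuclideanSpace ℝ (Fin n) → ℝ} (hK : ContDiffAt ℝ ∞ K (e x)) :
    DifferentiableAt ℝ K (e x) := hK.differentiableAt (by simp)
  have key : L (f * g) x = f x * L g x + g x * L f x + ∑ i, ∑ j, a i j (e x) *
      (partialD i (f ∘ e.symm) (e x) * partialD j (g ∘ e.symm) (e x) +
        partialD i (g ∘ e.symm) (e x) * partialD j (f ∘ e.symm) (e x)) := by
    rw [hf (f * g) x hx, hf f x hx, hf g x hx, hFG]
    simp only [partialD_partialD_mul hF hG, partialD_mul (hd hF) (hd hG), hFx, hGx, hc, mul_add,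
      Finset.sum_add_distrib, Finset.mul_sum]
    simp only [mul_left_comm]
    ring
  have hmul : carreDuChamp L f g x = (1 / 2) * (L (f * g) x - f x * L g x - g x * L f x) := rfl
  rw [hmul, key, add_assoc, add_sub_cancel_left, add_sub_cancel_left, Finset.mul_sum]
  refine Finset.sum_congr rfl fun i _ => ?_
  rw [Finset.mul_sum]
  refine Finset.sum_congr rfl fun j _ => ?_
  simp only [Matrix.of_apply]
  ring

theorem carreDuChamp_self_nonneg (hL : IsDiffusionOperator L) (h1 : L 1 = 0) (f : SmoothFn n M)
    (x : M) : 0 ≤ carreDuChamp L f f x := by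
  obtain ⟨a, ha, h⟩ := hL.carreDuChamp_apply h1 x
  rw [h]
  have := ha.dotProduct_mulVec_nonneg fun i =>
    partialD i (f ∘ (chartAt (EuclideanSpace ℝ (Fin n)) x).symm)
      (chartAt (EuclideanSpace ℝ (Fin n)) x x)
  refine this.trans_eq ?_
  simp only [dotProduct, Matrix.mulVec, Finset.mul_sum, Pi.star_apply, star_trivial]
  exact Finset.sum_congr rfl fun i _ => Finset.sum_congr rfl fun j _ => by ring

theorem carreDuChamp_mul_left (hL : IsDiffusionOperator L) (h1 : L 1 = 0) (f g h : SmoothFn n M)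
    (x : M) : carreDuChamp L (f * g) h x =
      f x * carreDuChamp L g h x + g x * carreDuChamp L f h x := by
  have he := chart_mem_atlas (EuclideanSpace ℝ (Fin n)) x
  have hx := mem_chart_source (EuclideanSpace ℝ (Fin n)) x
  obtain ⟨a, -, hΓ⟩ := hL.carreDuChamp_apply h1 x
  simp only [hΓ]
  set e := chartAt (EuclideanSpace ℝ (Fin n)) x
  have hF := (f.contDiffAt_comp_symm he hx).differentiableAt (by simp)
  have hG := (g.contDiffAt_comp_symm he hx).differentiableAt (by simp)
  have hFG : ((f * g : SmoothFn n M) : M → ℝ) ∘ e.symm = (f ∘ e.symm) * (g ∘ e.symm) := by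
    ext; simp
  have hFx : (f ∘ e.symm) (e x) = f x := by simp [e.left_inv hx]
  have hGx : (g ∘ e.symm) (e x) = g x := by simp [e.left_inv hx]
  rw [hFG]
  simp only [partialD_mul hF hG, hFx, hGx, Finset.mul_sum, ← Finset.sum_add_distrib]
  exact Finset.sum_congr rfl fun i _ => Finset.sum_congr rfl fun j _ => by ring

/-- Only differentiability of `φ` at the value `f x` is needed, since smoothness of the composite is
carried by `k`. This lets the rule apply to the logarithm, which is not smooth on all of `ℝ`. -/
theorem carreDuChamp_comp_left (hL : IsDiffusionOperator L) (h1 : L 1 = 0)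
    {f k : SmoothFn n M} {φ : ℝ → ℝ} (hk : ∀ x, k x = φ (f x)) {x : M} {c : ℝ}
    (hφ : HasDerivAt φ c (f x)) (h : SmoothFn n M) :
    carreDuChamp L k h x = c * carreDuChamp L f h x := by
  have he := chart_mem_atlas (EuclideanSpace ℝ (Fin n)) x
  have hx := mem_chart_source (EuclideanSpace ℝ (Fin n)) x
  obtain ⟨a, -, hΓ⟩ := hL.carreDuChamp_apply h1 x
  simp only [hΓ]
  set e := chartAt (EuclideanSpace ℝ (Fin n)) x
  have hF := (f.contDiffAt_comp_symm he hx).differentiableAt (by simp)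
  have hK : (k : M → ℝ) ∘ e.symm = φ ∘ (f ∘ e.symm) := by
    ext; simp [hk]
  have hFx : (f ∘ e.symm) (e x) = f x := by simp [e.left_inv hx]
  rw [hK]
  simp only [partialD_comp (hFx ▸ hφ) hF, Finset.mul_sum]
  exact Finset.sum_congr rfl fun i _ => Finset.sum_congr rfl fun j _ => by ring

end IsDiffusionOperator

end LocalCalculus

/-! ### Gronwall's inequality for a quadratic form along an abstract semigroup. -/

section Semigroup

variable {H : Type*} [NormedAddCommGroup H] [InnerProductSpace ℝ H] {P : ℝ → H →L[ℝ] H}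
  {S : H →L[ℝ] H} {c : ℝ}

/-- `P s` commutes with the difference quotients at `0`, so it preserves the domain of the
generator, and the orbit has right derivative `P s g`. -/
theorem hasDerivWithinAt_semigroup
    (hadd : ∀ s t : ℝ, 0 ≤ s → 0 ≤ t → P (s + t) = (P s).comp (P t)) {u g : H}
    (hu : Tendsto (fun h : ℝ => h⁻¹ • (P h u - u)) (𝓝[>] 0) (𝓝 g)) {s : ℝ} (hs : 0 ≤ s) :
    Tendsto (fun h : ℝ => h⁻¹ • (P h (P s u) - P s u)) (𝓝[>] 0) (𝓝 (P s g)) ∧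
      HasDerivWithinAt (fun r => P r u) (P s g) (Ici s) s := by
  have h1 := ((P s).continuous.tendsto g).comp hu
  constructor
  · refine h1.congr' ?_
    filter_upwards [self_mem_nhdsWithin] with h hh
    have : P h (P s u) = P s (P h u) := by
      rw [← ContinuousLinearMap.comp_apply, ← ContinuousLinearMap.comp_apply,
        ← hadd h s hh.le hs, ← hadd s h hs hh.le, add_comm]
    simp [this]
  · rw [hasDerivWithinAt_iff_tendsto_slope, Ici_sdiff_left]
    have h2 : Tendsto (fun r : ℝ => r - s) (𝓝[>] s) (𝓝[>] 0) := by
      refine tendsto_nhdsWithin_iff.2 ⟨?_, ?_⟩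
      · have : Tendsto (fun r : ℝ => r - s) (𝓝 s) (𝓝 (s - s)) :=
          (continuous_id.sub continuous_const).tendsto s
        rw [sub_self] at this
        exact this.mono_left nhdsWithin_le_nhds
      · filter_upwards [self_mem_nhdsWithin] with r hr
        exact sub_pos.2 (mem_Ioi.1 hr)
    refine (h1.comp h2).congr' ?_
    filter_upwards [self_mem_nhdsWithin] with r hr
    have : P r u = P s (P (r - s) u) := by
      rw [← ContinuousLinearMap.comp_apply, ← hadd s (r - s) hs (sub_pos.2 (mem_Ioi.1 hr)).le]
      congr 2
      ring
    simp [slope_def_module, this]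

/-- By symmetry of `S` the right derivative of `⟨S P_s u, P_s u⟩` is `2⟨S P_s u, P_s g⟩ ≤ 2c⟨S P_s
u, P_s u⟩`. Hence this quantity times `e^{-2cs}` has nonpositive right derivative and stays below
its initial value; right derivatives suffice for that comparison. -/
theorem inner_semigroup_le_of_mem_domain (hzero : P 0 = ContinuousLinearMap.id ℝ H)
    (hadd : ∀ s t : ℝ, 0 ≤ s → 0 ≤ t → P (s + t) = (P s).comp (P t))
    (hcont : ∀ f : H, ContinuousOn (fun t => P t f) (Ici 0))
    (hS : ∀ u v : H, inner ℝ (S u) v = inner ℝ u (S v))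
    (hdiss : ∀ u g : H, Tendsto (fun h : ℝ => h⁻¹ • (P h u - u)) (𝓝[>] 0) (𝓝 g) →
      inner ℝ (S u) g ≤ c * inner ℝ (S u) u)
    {u g : H} (hu : Tendsto (fun h : ℝ => h⁻¹ • (P h u - u)) (𝓝[>] 0) (𝓝 g))
    {t : ℝ} (ht : 0 ≤ t) :
    inner ℝ (S (P t u)) (P t u) ≤ Real.exp (2 * c * t) * inner ℝ (S u) u := by
  have hd (s : ℝ) (hs : 0 ≤ s) := hasDerivWithinAt_semigroup hadd hu hs
  have hcu : ContinuousOn (fun s => P s u) (Icc 0 t) := (hcont u).mono Icc_subset_Ici_self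
  have key := image_le_of_deriv_right_le_deriv_boundary (a := 0) (b := t)
    (f := fun s => Real.exp (-(2 * c) * s) * inner ℝ (S (P s u)) (P s u))
    (f' := fun s => Real.exp (-(2 * c) * s) * (-(2 * c)) * inner ℝ (S (P s u)) (P s u) +
      Real.exp (-(2 * c) * s) * (inner ℝ (S (P s u)) (P s g) + inner ℝ (S (P s g)) (P s u)))
    (B := fun _ => inner ℝ (S u) u) (B' := fun _ => 0)
    ((Continuous.continuousOn (by fun_prop)).mul
      ((S.continuous.comp_continuousOn hcu).inner hcu))
    (fun s hs => by
      have h1 := (hd s hs.1).2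
      have h2 := S.hasFDerivAt.comp_hasDerivWithinAt s h1
      have h3 : HasDerivWithinAt (fun s : ℝ => Real.exp (-(2 * c) * s))
          (Real.exp (-(2 * c) * s) * (-(2 * c))) (Ici s) s := by
        have := ((hasDerivAt_id s).const_mul (-(2 * c))).exp
        simpa using this.hasDerivWithinAt
      exact h3.mul (h2.inner ℝ h1))
    (by simp [hzero]) continuousOn_const (fun s _ => hasDerivWithinAt_const _ _ _)
    (fun s hs => by
      have h1 := hdiss _ _ (hd s hs.1).1
      have h2 : inner ℝ (S (P s g)) (P s u) = inner ℝ (S (P s u)) (P s g) := by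
        rw [hS, real_inner_comm]
      rw [h2]
      nlinarith [Real.exp_pos (-(2 * c) * s)])
    (right_mem_Icc.2 ht)
  calc inner ℝ (S (P t u)) (P t u)
      = Real.exp (2 * c * t) * (Real.exp (-(2 * c) * t) * inner ℝ (S (P t u)) (P t u)) := by
        rw [← mul_assoc, ← Real.exp_add]
        simp
    _ ≤ _ := by gcongr

theorem inner_semigroup_le (hzero : P 0 = ContinuousLinearMap.id ℝ H)
    (hadd : ∀ s t : ℝ, 0 ≤ s → 0 ≤ t → P (s + t) = (P s).comp (P t))
    (hcont : ∀ f : H, ContinuousOn (fun t => P t f) (Ici 0))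
    (hS : ∀ u v : H, inner ℝ (S u) v = inner ℝ u (S v))
    (hdiss : ∀ u g : H, Tendsto (fun h : ℝ => h⁻¹ • (P h u - u)) (𝓝[>] 0) (𝓝 g) →
      inner ℝ (S u) g ≤ c * inner ℝ (S u) u)
    (hdense : Dense {u : H | ∃ g, Tendsto (fun h : ℝ => h⁻¹ • (P h u - u)) (𝓝[>] 0) (𝓝 g)})
    (u : H) {t : ℝ} (ht : 0 ≤ t) :
    inner ℝ (S (P t u)) (P t u) ≤ Real.exp (2 * c * t) * inner ℝ (S u) u := by
  have hc : IsClosed {u : H | inner ℝ (S (P t u)) (P t u) ≤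
      Real.exp (2 * c * t) * inner ℝ (S u) u} :=
    isClosed_le (by fun_prop) (by fun_prop)
  refine hc.closure_subset_iff.2 ?_ (hdense u)
  rintro v ⟨g, hg⟩
  exact inner_semigroup_le_of_mem_domain hzero hadd hcont hS hdiss hg ht

end Semigroup

/-! ### Bounded multiplication operators on `L²`. -/

section MulOperator

variable {M : Type*} [MeasurableSpace M] {μ : Measure M}

/-- Multiplication by an essentially bounded function, as an operator on `L²`. -/
noncomputable def mulLp {η : M → ℝ} (hη : MemLp η ∞ μ) : Lp ℝ 2 μ →L[ℝ] Lp ℝ 2 μ :=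
  (ContinuousLinearMap.mul ℝ ℝ).holderL μ ∞ 2 2 (hη.toLp η)

theorem coeFn_mulLp {η : M → ℝ} (hη : MemLp η ∞ μ) (u : Lp ℝ 2 μ) :
    mulLp hη u =ᵐ[μ] fun x => η x * u x := by
  filter_upwards [(ContinuousLinearMap.mul ℝ ℝ).coeFn_holder (r := 2) (hη.toLp η) u,
    hη.coeFn_toLp] with x hx hx'
  change ((ContinuousLinearMap.mul ℝ ℝ).holder 2 (hη.toLp η) u) x = _
  rw [hx, hx']
  simp

theorem inner_mulLp {η : M → ℝ} (hη : MemLp η ∞ μ) (u v : Lp ℝ 2 μ) :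
    inner ℝ (mulLp hη u) v = ∫ x, η x * u x * v x ∂μ := by
  rw [L2.inner_def]
  refine integral_congr_ae ?_
  filter_upwards [coeFn_mulLp hη u] with x hx
  rw [hx]
  simp [mul_comm]

theorem inner_mulLp_comm {η : M → ℝ} (hη : MemLp η ∞ μ) (u v : Lp ℝ 2 μ) :
    inner ℝ (mulLp hη u) v = inner ℝ u (mulLp hη v) := by
  rw [real_inner_comm _ u, inner_mulLp, inner_mulLp]
  exact integral_congr_ae (Eventually.of_forall fun x => by ring)

end MulOperator

/-! ### Integration by parts and energy estimates on test functions. -/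

section Energy

variable {n : ℕ} {M : Type*} [TopologicalSpace M] [ChartedSpace (EuclideanSpace ℝ (Fin n)) M]
  {L : SmoothFn n M →ₗ[ℝ] SmoothFn n M}

theorem IsDiffusionOperator.hasCompactSupport_apply (hL : IsDiffusionOperator L)
    {f : SmoothFn n M} (hf : HasCompactSupport f) : HasCompactSupport (L f) := by
  refine hf.mono' fun x hx => ?_
  by_contra h
  refine hx ?_
  have : (f : M → ℝ) =ᶠ[𝓝 x] (0 : SmoothFn n M) := notMem_tsupport_iff_eventuallyEq.1 h
  rw [hL.apply_congr this, map_zero]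
  rfl

theorem SmoothFn.hasCompactSupport_mul_left {f : SmoothFn n M} (hf : HasCompactSupport f)
    (g : SmoothFn n M) : HasCompactSupport (f * g : SmoothFn n M) := by
  rw [ContMDiffMap.coe_mul]
  exact hf.mul_right

theorem SmoothFn.hasCompactSupport_mul_right {f : SmoothFn n M} (hf : HasCompactSupport f)
    (g : SmoothFn n M) : HasCompactSupport (g * f : SmoothFn n M) := by
  rw [mul_comm]
  exact hasCompactSupport_mul_left hf g

theorem SmoothFn.hasCompactSupport_sub {f g : SmoothFn n M} (hf : HasCompactSupport f)
    (hg : HasCompactSupport g) : HasCompactSupport (f - g : SmoothFn n M) := by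
  rw [ContMDiffMap.coe_sub]
  exact hf.sub hg

theorem IsDiffusionOperator.hasCompactSupport_carreDuChamp_left (hL : IsDiffusionOperator L)
    {f : SmoothFn n M} (hf : HasCompactSupport f) (g : SmoothFn n M) :
    HasCompactSupport (carreDuChamp L f g) := by
  have h1 := hL.hasCompactSupport_apply (SmoothFn.hasCompactSupport_mul_left hf g)
  have h2 := SmoothFn.hasCompactSupport_mul_left hf (L g)
  have h3 := SmoothFn.hasCompactSupport_mul_right (hL.hasCompactSupport_apply hf) g
  have h4 := SmoothFn.hasCompactSupport_sub (SmoothFn.hasCompactSupport_sub h1 h2) h3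
  exact h4.smul_left (f := fun _ => (1 / 2 : ℝ))

variable [MeasurableSpace M] [BorelSpace M] {μ : Measure M}

/-- The density is continuous in the chart, hence bounded on a small ball around the point. -/
theorem IsSmoothMeasure.isLocallyFiniteMeasure (hμ : IsSmoothMeasure n μ) :
    IsLocallyFiniteMeasure μ := by
  refine ⟨fun x => ?_⟩
  set e := chartAt (EuclideanSpace ℝ (Fin n)) x
  have hx : x ∈ e.source := mem_chart_source _ x
  obtain ⟨ρ, hρ, -, hmap⟩ := hμ e (chart_mem_atlas _ x)
  have hcont : ContinuousAt ρ (e x) :=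
    hρ.continuousOn.continuousAt (e.open_target.mem_nhds (e.map_source hx))
  obtain ⟨V, hV, hVo, hxV⟩ := _root_.mem_nhds_iff.1 ((hcont.eventually_lt_const
    (lt_add_one (ρ (e x)))).and (Metric.ball_mem_nhds (e x) one_pos))
  refine ⟨e.source ∩ e ⁻¹' V, (e.isOpen_inter_preimage hVo).mem_nhds ⟨hx, hxV⟩, ?_⟩
  have hae : AEMeasurable e (μ.restrict e.source) :=
    e.continuousOn.aemeasurable e.open_source.measurableSet
  calc μ (e.source ∩ e ⁻¹' V) ≤ μ.restrict e.source (e ⁻¹' V) := by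
        rw [inter_comm]
        exact Measure.le_restrict_apply _ _
    _ ≤ (μ.restrict e.source).map e V := Measure.le_map_apply hae V
    _ = ∫⁻ y in V, ENNReal.ofReal (ρ y) ∂(volume.restrict e.target) := by
        rw [hmap, withDensity_apply _ hVo.measurableSet]
    _ ≤ ∫⁻ y in V, ENNReal.ofReal (ρ (e x) + 1) ∂(volume.restrict e.target) :=
        setLIntegral_mono measurable_const fun y hy => ENNReal.ofReal_le_ofReal (hV hy).1.le
    _ = ENNReal.ofReal (ρ (e x) + 1) * volume.restrict e.target V := by
        rw [setLIntegral_const]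
    _ < ⊤ := by
        refine ENNReal.mul_lt_top ENNReal.ofReal_lt_top
          (((Measure.restrict_apply_le _ _).trans (measure_mono fun y hy => (hV hy).2)).trans_lt
            measure_ball_lt_top)

theorem SmoothFn.integrable [IsFiniteMeasureOnCompacts μ] (f : SmoothFn n M)
    (hf : HasCompactSupport f) : Integrable f μ :=
  f.contMDiff.continuous.integrable_of_hasCompactSupport hf

theorem SmoothFn.memLp [IsFiniteMeasureOnCompacts μ] (f : SmoothFn n M)
    (hf : HasCompactSupport f) : MemLp f 2 μ :=
  f.contMDiff.continuous.memLp_of_hasCompactSupport hf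

variable [IsManifold (𝓡 n) ∞ M] [IsFiniteMeasureOnCompacts μ]

namespace IsSubRiemannianOperator

/-- Multiplication by `η` preserves finite energy: `Γ(ηw) ≤ 2η²Γ(w) + 2w²Γ(η)`. -/
theorem integral_carreDuChamp_mul_self_le (h : IsSubRiemannianOperator μ L) {w η : SmoothFn n M}
    (hw : HasCompactSupport w) {a b : ℝ} (ha : ∀ x, (η x) ^ 2 ≤ a)
    (hb : ∀ᵐ x ∂μ, carreDuChamp L η η x ≤ b) :
    ∫ x, carreDuChamp L (η * w) (η * w) x ∂μ ≤
      2 * a * ∫ x, carreDuChamp L w w x ∂μ + 2 * b * ∫ x, (w x) ^ 2 ∂μ := by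
  have i1 := (carreDuChamp L w w).integrable (μ := μ)
    (h.diffusion.hasCompactSupport_carreDuChamp_left hw _)
  have i2 : Integrable (fun x => (w x) ^ 2) μ := (w.memLp hw).integrable_sq
  rw [← integral_const_mul, ← integral_const_mul, ← integral_add (i1.const_mul _) (i2.const_mul _)]
  refine integral_mono_ae ((carreDuChamp L (η * w) (η * w)).integrable
    (h.diffusion.hasCompactSupport_carreDuChamp_left
      (SmoothFn.hasCompactSupport_mul_right hw _) _))
    ((i1.const_mul _).add (i2.const_mul _)) ?_
  filter_upwards [hb] with x hx
  have hl := h.diffusion.carreDuChamp_mul_left h.map_one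
  have h0 := h.diffusion.carreDuChamp_self_nonneg h.map_one
  have e1 : carreDuChamp L (η * w) (η * w) x = η x ^ 2 * carreDuChamp L w w x +
      2 * η x * w x * carreDuChamp L η w x + w x ^ 2 * carreDuChamp L η η x := by
    rw [hl, carreDuChamp_comm w (η * w), carreDuChamp_comm η (η * w), hl, hl,
      carreDuChamp_comm w η]
    ring
  have e3 : 0 ≤ η x ^ 2 * carreDuChamp L w w x -
      2 * η x * w x * carreDuChamp L η w x + w x ^ 2 * carreDuChamp L η η x := by
    -- The values at `x` are frozen as constants, so bilinearity alone expands the square.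
    have h3 := h0 ((η x) • w + (-w x) • η) x
    simp only [carreDuChamp_add_left, carreDuChamp_add_right, carreDuChamp_smul_left,
      carreDuChamp_smul_right, carreDuChamp_comm w η, ContMDiffMap.coe_add, ContMDiffMap.coe_smul,
      Pi.add_apply, Pi.smul_apply, smul_eq_mul] at h3
    nlinarith
  have h4 := mul_le_mul_of_nonneg_right (ha x) (h0 w x)
  have h5 := mul_le_mul_of_nonneg_left hx (sq_nonneg (w x))
  rw [e1]
  nlinarith

/-- The dissipation estimate at the heart of the method. Leibniz gives `Γ(w, φ²w) = φ²Γ(w) + 2φw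
Γ(φ,w)`, and positivity of the completed square `φ²Γ(w) + 2φw Γ(φ,w) + w²Γ(φ)` bounds its negative
by `w²Γ(φ) ≤ cφ²w²`. -/
theorem neg_integral_carreDuChamp_sq_mul_le (h : IsSubRiemannianOperator μ L)
    {w φ : SmoothFn n M} (hw : HasCompactSupport w) {c : ℝ}
    (hc : ∀ᵐ x ∂μ, carreDuChamp L φ φ x ≤ c * φ x ^ 2) :
    -∫ x, carreDuChamp L w (φ * φ * w) x ∂μ ≤ c * ∫ x, φ x ^ 2 * w x * w x ∂μ := by
  have hφw := SmoothFn.hasCompactSupport_mul_right hw φ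
  rw [← integral_neg, ← integral_const_mul]
  refine integral_mono_ae ((carreDuChamp L w (φ * φ * w)).integrable
    (h.diffusion.hasCompactSupport_carreDuChamp_left hw _)).neg ?_ ?_
  · refine (((φ * w).memLp hφw).integrable_sq.const_mul c).congr
      (Eventually.of_forall fun x => ?_)
    simp only [ContMDiffMap.coe_mul, Pi.mul_apply]
    ring
  · filter_upwards [hc] with x hx
    have hl := h.diffusion.carreDuChamp_mul_left h.map_one
    have h0 := h.diffusion.carreDuChamp_self_nonneg h.map_one
    have e1 : carreDuChamp L w (φ * φ * w) x =
        φ x ^ 2 * carreDuChamp L w w x + 2 * φ x * w x * carreDuChamp L φ w x := by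
      rw [carreDuChamp_comm, hl, hl]
      simp only [ContMDiffMap.coe_mul, Pi.mul_apply]
      ring
    have e3 : 0 ≤ φ x ^ 2 * carreDuChamp L w w x +
        2 * φ x * w x * carreDuChamp L φ w x + w x ^ 2 * carreDuChamp L φ φ x := by
      have h3 := h0 ((φ x) • w + (w x) • φ) x
      simp only [carreDuChamp_add_left, carreDuChamp_add_right, carreDuChamp_smul_left,
        carreDuChamp_smul_right, carreDuChamp_comm w φ, ContMDiffMap.coe_add,
        ContMDiffMap.coe_smul, Pi.add_apply, Pi.smul_apply, smul_eq_mul] at h3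
      nlinarith
    have h5 := mul_le_mul_of_nonneg_left hx (sq_nonneg (w x))
    simp only [e1]
    nlinarith

/-- A quantitative Cauchy–Schwarz inequality: expand the nonnegative energy of `v + θw` and divide
by `2θ`. It makes the cross term small when `v` has small energy and `w` bounded energy. -/
theorem neg_integral_carreDuChamp_le (h : IsSubRiemannianOperator μ L) {v w : SmoothFn n M}
    (hv : HasCompactSupport v) (hw : HasCompactSupport w) {θ K : ℝ} (hθ : 0 < θ)
    (hvθ : ∫ x, carreDuChamp L v v x ∂μ ≤ θ ^ 2) (hwK : ∫ x, carreDuChamp L w w x ∂μ ≤ K) :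
    -∫ x, carreDuChamp L v w x ∂μ ≤ θ * (1 + K) / 2 := by
  have h0 : 0 ≤ ∫ x, carreDuChamp L (v + θ • w) (v + θ • w) x ∂μ :=
    integral_nonneg fun x => h.diffusion.carreDuChamp_self_nonneg h.map_one _ x
  have i1 := (carreDuChamp L v v).integrable (μ := μ)
    (h.diffusion.hasCompactSupport_carreDuChamp_left hv _)
  have i2 := (carreDuChamp L v w).integrable (μ := μ)
    (h.diffusion.hasCompactSupport_carreDuChamp_left hv _)
  have i3 := (carreDuChamp L w w).integrable (μ := μ)
    (h.diffusion.hasCompactSupport_carreDuChamp_left hw _)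
  have e : ∫ x, carreDuChamp L (v + θ • w) (v + θ • w) x ∂μ = ∫ x, carreDuChamp L v v x ∂μ +
      2 * θ * ∫ x, carreDuChamp L v w x ∂μ + θ ^ 2 * ∫ x, carreDuChamp L w w x ∂μ := by
    rw [← integral_const_mul, ← integral_const_mul, ← integral_add i1 (i2.const_mul _),
      ← integral_add
        (f := fun x => carreDuChamp L v v x + 2 * θ * carreDuChamp L v w x)
        (i1.add (i2.const_mul _)) (i3.const_mul _)]
    refine integral_congr_ae (Eventually.of_forall fun x => ?_)
    simp only [carreDuChamp_add_left, carreDuChamp_add_right, carreDuChamp_smul_left,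
      carreDuChamp_smul_right, carreDuChamp_comm w v, ContMDiffMap.coe_add,
      ContMDiffMap.coe_smul, Pi.add_apply, Pi.smul_apply, smul_eq_mul]
    ring
  rw [e] at h0
  have h1 := mul_le_mul_of_nonneg_left hwK (sq_nonneg θ)
  have h2 : 0 ≤ θ * (θ * (1 + K) / 2 - -∫ x, carreDuChamp L v w x ∂μ) := by nlinarith
  linarith [nonneg_of_mul_nonneg_right h2 hθ]

variable [T2Space M] [SecondCountableTopology M]

/-- With a cutoff `χ` equal to `1` near the support of `f`, symmetry gives `∫ Lf = ∫ χ Lf = ∫ f Lχ`,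
and `Lχ = L1 = 0` on that support by locality. -/
theorem integral_apply_eq_zero (h : IsSubRiemannianOperator μ L) {f : SmoothFn n M}
    (hf : HasCompactSupport f) : ∫ x, L f x ∂μ = 0 := by
  have : LocallyCompactSpace M := Manifold.locallyCompact_of_finiteDimensional (𝓡 n)
  obtain ⟨t, ht, hft⟩ := exists_compact_superset hf
  obtain ⟨χ, h1, h0, -⟩ := exists_contMDiffMap_one_nhds_of_subset_interior (n := ⊤) (𝓡 n)
    (isClosed_tsupport f) hft
  rw [eventually_nhdsSet_iff_forall] at h1
  have hχ : HasCompactSupport χ := HasCompactSupport.intro ht h0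
  have h2 : ∫ x, f x * L χ x ∂μ = 0 := by
    refine integral_eq_zero_of_ae (Eventually.of_forall fun x => ?_)
    by_cases hx : x ∈ tsupport f
    · have : (χ : M → ℝ) =ᶠ[𝓝 x] (1 : SmoothFn n M) := h1 x hx
      simp [h.diffusion.apply_congr this, h.map_one]
    · simp [image_eq_zero_of_notMem_tsupport hx]
  rw [← h2, ← h.symm χ f hχ hf]
  refine integral_congr_ae (Eventually.of_forall fun x => ?_)
  by_cases hx : x ∈ tsupport f
  · simp [(h1 x hx).self_of_nhds]
  · have : (f : M → ℝ) =ᶠ[𝓝 x] (0 : SmoothFn n M) := notMem_tsupport_iff_eventuallyEq.1 hx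
    simp [h.diffusion.apply_congr this]

theorem integral_carreDuChamp (h : IsSubRiemannianOperator μ L) {f g : SmoothFn n M}
    (hf : HasCompactSupport f) (hg : HasCompactSupport g) :
    ∫ x, carreDuChamp L f g x ∂μ = -∫ x, f x * L g x ∂μ := by
  have hfg := SmoothFn.hasCompactSupport_mul_left hf g
  have i1 := (L (f * g)).integrable (μ := μ) (h.diffusion.hasCompactSupport_apply hfg)
  have i2 : Integrable (fun x => f x * L g x) μ :=
    (f * L g).integrable (SmoothFn.hasCompactSupport_mul_left hf _)
  have i3 : Integrable (fun x => g x * L f x) μ :=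
    (g * L f).integrable (SmoothFn.hasCompactSupport_mul_left hg _)
  have e : ∫ x, carreDuChamp L f g x ∂μ =
      (1 / 2) * (∫ x, L (f * g) x ∂μ - ∫ x, f x * L g x ∂μ - ∫ x, g x * L f x ∂μ) := by
    rw [← integral_sub i1 i2, ← integral_sub (f := fun x => L (f * g) x - f x * L g x)
      (i1.sub i2) i3, ← integral_const_mul]
    rfl
  rw [e, h.integral_apply_eq_zero hfg, h.symm g f hg hf]
  ring

end IsSubRiemannianOperator

end Energy

/-! ### The weighted dissipation inequality on the Friedrichs domain, and weighted `L²` growth of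
the semigroup. -/

section HeatSemigroup

variable {n : ℕ} {M : Type*} [TopologicalSpace M] [ChartedSpace (EuclideanSpace ℝ (Fin n)) M]
  [MeasurableSpace M] [BorelSpace M] {μ : Measure M} {L : SmoothFn n M →ₗ[ℝ] SmoothFn n M}

theorem IsSubRiemannianOperator.friedrichsGraph_toLp [IsFiniteMeasureOnCompacts μ] (h : IsSubRiemannianOperator μ L)
    {φ : SmoothFn n M} (hφ : HasCompactSupport φ) :
    FriedrichsGraph μ L ((φ.memLp hφ).toLp φ)
      (((L φ).memLp (h.diffusion.hasCompactSupport_apply hφ)).toLp (L φ)) := by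
  refine ⟨fun χ hχ => ?_, fun _ => φ, fun _ => hφ, ?_, fun ε hε => ⟨0, fun _ _ _ _ => ?_⟩⟩
  · have e1 : ∫ x, ((φ.memLp hφ).toLp φ : Lp ℝ 2 μ) x * L χ x ∂μ = ∫ x, φ x * L χ x ∂μ := by
      refine integral_congr_ae ?_
      filter_upwards [(φ.memLp (μ := μ) hφ).coeFn_toLp] with x hx
      rw [hx]
    rw [e1, h.symm φ χ hφ hχ]
    refine integral_congr_ae ?_
    filter_upwards [((L φ).memLp (μ := μ) (h.diffusion.hasCompactSupport_apply hφ)).coeFn_toLp]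
      with x hx
    rw [hx, mul_comm]
  · have : eLpNorm (fun x => φ x - ((φ.memLp hφ).toLp φ : Lp ℝ 2 μ) x) 2 μ = 0 := by
      rw [eLpNorm_congr_ae (g := fun _ => 0), eLpNorm_zero']
      filter_upwards [(φ.memLp (μ := μ) hφ).coeFn_toLp] with x hx
      rw [hx, sub_self]
    simp [this]
  · simpa using hε

variable [IsManifold (𝓡 n) ∞ M] [T2Space M] [SecondCountableTopology M]

namespace IsSubRiemannianOperator

/-- An energy-Cauchy sequence is eventually bounded in energy, by `Γ(v + w) ≤ 2Γ(v) + 2Γ(w)` with `v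
= w_k - w_N`. -/
theorem exists_energy_bound [IsFiniteMeasureOnCompacts μ] (h : IsSubRiemannianOperator μ L)
    {w : ℕ → SmoothFn n M} (hw : ∀ k, HasCompactSupport (w k))
    (hcauchy : ∀ ε : ℝ, 0 < ε → ∃ N, ∀ j ≥ N, ∀ k ≥ N,
      -∫ x, (w j - w k) x * L (w j - w k) x ∂μ < ε) :
    ∃ K, ∃ N, ∀ k ≥ N, ∫ x, carreDuChamp L (w k) (w k) x ∂μ ≤ K := by
  obtain ⟨N, hN⟩ := hcauchy 1 one_pos
  refine ⟨2 * 1 + 2 * ∫ x, carreDuChamp L (w N) (w N) x ∂μ, N, fun k hk => ?_⟩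
  have hd := SmoothFn.hasCompactSupport_sub (hw k) (hw N)
  have h1 := hN k hk N le_rfl
  rw [← h.integral_carreDuChamp hd hd] at h1
  have i (v : SmoothFn n M) (hv : HasCompactSupport v) :
      Integrable (fun x => carreDuChamp L v v x) μ := (carreDuChamp L v v).integrable (μ := μ)
    (h.diffusion.hasCompactSupport_carreDuChamp_left hv _)
  calc ∫ x, carreDuChamp L (w k) (w k) x ∂μ
      ≤ ∫ x, (2 * carreDuChamp L (w k - w N) (w k - w N) x +
          2 * carreDuChamp L (w N) (w N) x) ∂μ := by
        refine integral_mono (i _ (hw k)) (((i _ hd).const_mul _).add ((i _ (hw N)).const_mul _))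
          fun x => ?_
        have h3 := h.diffusion.carreDuChamp_self_nonneg h.map_one
          ((w k - w N) + (-1 : ℝ) • w N) x
        have h4 : w k = (w k - w N) + w N := by simp
        rw [h4]
        generalize w k - w N = v at *
        simp only [add_sub_cancel_right, carreDuChamp_add_left, carreDuChamp_add_right,
          carreDuChamp_smul_left, carreDuChamp_smul_right, carreDuChamp_comm (w N) v,
          ContMDiffMap.coe_add, ContMDiffMap.coe_smul, Pi.add_apply, Pi.smul_apply,
          smul_eq_mul] at h3 ⊢
        linarith
    _ = 2 * ∫ x, carreDuChamp L (w k - w N) (w k - w N) x ∂μ +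
          2 * ∫ x, carreDuChamp L (w N) (w N) x ∂μ := by
        rw [integral_add ((i _ hd).const_mul _) ((i _ (hw N)).const_mul _),
          integral_const_mul, integral_const_mul]
    _ ≤ _ := by gcongr

/-- Formally `⟨φ²u, Lu⟩ = -∫ Γ(u, φ²u) ≤ c ∫ φ²u²`. For approximants `w_k` of `u`, the function
`φ²w_k` is a legitimate test function; moving `L` onto it and replacing `u` by `w_j` gives `-∫
Γ(w_j, φ²w_k)`. This is the expected term in `w_k` plus an error in `w_j - w_k`, small because
`φ²w_k` has energy bounded in `k`. The limits are taken in the order `j → ∞`, `k → ∞`, `θ → 0`. -/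
theorem inner_mulLp_le_of_friedrichsGraph [IsFiniteMeasureOnCompacts μ]
    (h : IsSubRiemannianOperator μ L)
    {φ : SmoothFn n M} {B c : ℝ} (hc : 0 ≤ c) (hB : ∀ x, φ x ^ 2 ≤ B)
    (hφ : ∀ᵐ x ∂μ, carreDuChamp L φ φ x ≤ c * φ x ^ 2) (hη : MemLp (fun x => φ x ^ 2) ∞ μ)
    {u g : Lp ℝ 2 μ} (hu : FriedrichsGraph μ L u g) :
    inner ℝ (mulLp hη u) g ≤ c * inner ℝ (mulLp hη u) u := by
  obtain ⟨hweak, w, hw, hlim, hcauchy⟩ := hu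
  obtain ⟨K₁, N₁, hK₁⟩ := h.exists_energy_bound hw hcauchy
  set W : ℕ → Lp ℝ 2 μ := fun k => ((w k).memLp (hw k)).toLp (w k)
  have hWlim : Tendsto W atTop (𝓝 u) := by
    have := (Lp.tendsto_Lp_iff_tendsto_eLpNorm'' (fun k x => w k x)
      (fun k => (w k).memLp (μ := μ) (hw k)) u (Lp.memLp u)).2 hlim
    rwa [Lp.toLp_coeFn] at this
  obtain ⟨K₂, hK₂⟩ : ∃ K₂, ∀ k, ‖W k‖ ≤ K₂ := by
    obtain ⟨K, hK⟩ := hWlim.norm.bddAbove_range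
    exact ⟨K, fun k => hK ⟨k, rfl⟩⟩
  have hWsq (k : ℕ) : ∫ x, w k x ^ 2 ∂μ ≤ K₂ ^ 2 := by
    have e : ∫ x, w k x ^ 2 ∂μ = ‖W k‖ ^ 2 := by
      rw [← real_inner_self_eq_norm_sq, L2.inner_def]
      refine integral_congr_ae ?_
      filter_upwards [((w k).memLp (μ := μ) (hw k)).coeFn_toLp] with x hx
      simp [W, hx, sq]
    rw [e]
    exact pow_le_pow_left₀ (norm_nonneg _) (hK₂ k) 2
  have hψ (k : ℕ) : HasCompactSupport (φ * φ * w k : SmoothFn n M) :=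
    SmoothFn.hasCompactSupport_mul_right (hw k) _
  -- The bound of `integral_carreDuChamp_mul_self_le` for `η = φ²`, where `η² ≤ B²` and `Γ(φ²) =
  -- 4φ²Γ(φ) ≤ 4cB²`.
  set K : ℝ := 2 * B ^ 2 * |K₁| + 2 * (4 * c * B ^ 2) * K₂ ^ 2
  have hφφ : ∀ᵐ x ∂μ, carreDuChamp L (φ * φ) (φ * φ) x ≤ 4 * c * B ^ 2 := by
    filter_upwards [hφ] with x hx
    have hl := h.diffusion.carreDuChamp_mul_left h.map_one
    have e1 : carreDuChamp L (φ * φ) (φ * φ) x = 4 * φ x ^ 2 * carreDuChamp L φ φ x := by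
      rw [hl, carreDuChamp_comm φ (φ * φ), hl]
      ring
    have h2 : (φ x ^ 2) ^ 2 ≤ B ^ 2 := pow_le_pow_left₀ (sq_nonneg _) (hB x) 2
    have h3 := mul_le_mul_of_nonneg_left hx (sq_nonneg (φ x))
    have h4 := mul_le_mul_of_nonneg_left h2 hc
    rw [e1]
    nlinarith
  have hψK (k : ℕ) (hk : N₁ ≤ k) :
      ∫ x, carreDuChamp L (φ * φ * w k) (φ * φ * w k) x ∂μ ≤ K := by
    refine (h.integral_carreDuChamp_mul_self_le (hw k) (a := B ^ 2) (fun x => ?_) hφφ).trans ?_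
    · have h2 : (φ x ^ 2) ^ 2 ≤ B ^ 2 := pow_le_pow_left₀ (sq_nonneg _) (hB x) 2
      simp only [ContMDiffMap.coe_mul, Pi.mul_apply]
      linarith
    · have h1 : ∫ x, carreDuChamp L (w k) (w k) x ∂μ ≤ |K₁| := (hK₁ k hk).trans (le_abs_self _)
      exact add_le_add (mul_le_mul_of_nonneg_left h1 (by positivity))
        (mul_le_mul_of_nonneg_left (hWsq k) (by positivity))
  have hmain (θ : ℝ) (hθ : 0 < θ) :
      inner ℝ (mulLp hη u) g ≤ c * inner ℝ (mulLp hη u) u + θ * (1 + K) / 2 := by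
    obtain ⟨N, hN⟩ := hcauchy (θ ^ 2) (by positivity)
    have hk : ∀ᶠ k in atTop,
        inner ℝ (mulLp hη (W k)) g ≤ c * inner ℝ (mulLp hη (W k)) (W k) + θ * (1 + K) / 2 := by
      filter_upwards [eventually_ge_atTop N, eventually_ge_atTop N₁] with k hkN hkN₁
      have e1 : inner ℝ (mulLp hη (W k)) g = ∫ x, u x * L (φ * φ * w k) x ∂μ := by
        rw [hweak _ (hψ k), inner_mulLp]
        refine integral_congr_ae ?_
        filter_upwards [((w k).memLp (μ := μ) (hw k)).coeFn_toLp] with x hx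
        simp only [W, hx, ContMDiffMap.coe_mul, Pi.mul_apply]
        ring
      have e2 : inner ℝ (mulLp hη (W k)) (W k) = ∫ x, φ x ^ 2 * w k x * w k x ∂μ := by
        rw [inner_mulLp]
        refine integral_congr_ae ?_
        filter_upwards [((w k).memLp (μ := μ) (hw k)).coeFn_toLp] with x hx
        simp only [W, hx]
      have hLm : MemLp (L (φ * φ * w k)) 2 μ :=
        SmoothFn.memLp _ (h.diffusion.hasCompactSupport_apply (hψ k))
      have e3 (v : Lp ℝ 2 μ) :
          inner ℝ v (hLm.toLp _) = ∫ x, v x * L (φ * φ * w k) x ∂μ := by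
        rw [L2.inner_def]
        refine integral_congr_ae ?_
        filter_upwards [hLm.coeFn_toLp] with x hx
        simp only [hx, RCLike.inner_apply, conj_trivial]
        exact mul_comm _ _
      rw [e1, e2, ← e3]
      refine le_of_tendsto (hWlim.inner tendsto_const_nhds) ?_
      filter_upwards [eventually_ge_atTop N] with j hj
      have e4 : inner ℝ (W j) (hLm.toLp _) =
          -∫ x, carreDuChamp L (w j) (φ * φ * w k) x ∂μ := by
        rw [e3, h.integral_carreDuChamp (hw j) (hψ k), neg_neg]
        refine integral_congr_ae ?_
        filter_upwards [((w j).memLp (μ := μ) (hw j)).coeFn_toLp] with x hx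
        simp only [W, hx]
      have hd := SmoothFn.hasCompactSupport_sub (hw j) (hw k)
      have e5 : ∫ x, carreDuChamp L (w j) (φ * φ * w k) x ∂μ =
          ∫ x, carreDuChamp L (w k) (φ * φ * w k) x ∂μ +
            ∫ x, carreDuChamp L (w j - w k) (φ * φ * w k) x ∂μ := by
        rw [← integral_add (SmoothFn.integrable _
          (h.diffusion.hasCompactSupport_carreDuChamp_left (hw k) _)) (SmoothFn.integrable _
          (h.diffusion.hasCompactSupport_carreDuChamp_left hd _))]
        refine integral_congr_ae (Eventually.of_forall fun x => ?_)
        have : w j = w k + (w j - w k) := by simp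
        conv_lhs => rw [this, carreDuChamp_add_left]
        rfl
      have h1 := h.neg_integral_carreDuChamp_sq_mul_le (hw k) hφ
      have h2 := h.neg_integral_carreDuChamp_le hd (hψ k) hθ
        (by rw [h.integral_carreDuChamp hd hd]; exact (hN j hj k hkN).le) (hψK k hkN₁)
      rw [e4, e5]
      linarith
    have hMlim : Tendsto (fun k => mulLp hη (W k)) atTop (𝓝 (mulLp hη u)) :=
      ((mulLp hη).continuous.tendsto u).comp hWlim
    exact le_of_tendsto_of_tendsto (hMlim.inner tendsto_const_nhds)
      (((hMlim.inner hWlim).const_mul c).add_const _) hk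
  have hlim0 : Tendsto (fun θ : ℝ => c * inner ℝ (mulLp hη u) u + θ * (1 + K) / 2) (𝓝[>] 0)
      (𝓝 (c * inner ℝ (mulLp hη u) u + 0 * (1 + K) / 2)) :=
    (Continuous.tendsto (by fun_prop) 0).mono_left nhdsWithin_le_nhds
  rw [zero_mul, zero_div, add_zero] at hlim0
  exact ge_of_tendsto hlim0 (by filter_upwards [self_mem_nhdsWithin] with θ hθ using hmain θ hθ)

end IsSubRiemannianOperator

variable (n μ) in
/-- The smooth functions with compact support, as a subspace of `L²`. -/
noncomputable def smoothCompactLp [IsFiniteMeasureOnCompacts μ] : Submodule ℝ (Lp ℝ 2 μ) where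
  carrier := {u | ∃ (φ : SmoothFn n M) (hφ : HasCompactSupport φ), (φ.memLp hφ).toLp φ = u}
  add_mem' := by
    rintro _ _ ⟨φ, hφ, rfl⟩ ⟨χ, hχ, rfl⟩
    exact ⟨φ + χ, hφ.add hχ, MemLp.toLp_add _ _⟩
  zero_mem' := ⟨0, HasCompactSupport.zero, MemLp.toLp_zero _⟩
  smul_mem' := by
    rintro c _ ⟨φ, hφ, rfl⟩
    exact ⟨c • φ, hφ.smul_left (f := fun _ => c), MemLp.toLp_const_smul c _⟩

theorem dense_smoothCompactLp [IsLocallyFiniteMeasure μ] :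
    Dense (smoothCompactLp n μ : Set (Lp ℝ 2 μ)) := by
  have : LocallyCompactSpace M := Manifold.locallyCompact_of_finiteDimensional (𝓡 n)
  rw [Submodule.dense_iff_topologicalClosure_eq_top, Submodule.topologicalClosure_eq_top_iff,
    Submodule.eq_bot_iff]
  intro v hv
  rw [Submodule.mem_orthogonal] at hv
  refine Lp.eq_zero_iff_ae_eq_zero.2 ?_
  refine ae_eq_zero_of_integral_contMDiff_smul_eq_zero (𝓡 n)
    ((Lp.memLp v).locallyIntegrable (by norm_num)) fun g hg hgs => ?_
  have hm : MemLp g 2 μ := hg.continuous.memLp_of_hasCompactSupport hgs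
  rw [← hv (hm.toLp g) ⟨⟨g, hg⟩, hgs, rfl⟩, L2.inner_def]
  refine integral_congr_ae ?_
  filter_upwards [hm.coeFn_toLp] with x hx
  simp [hx, mul_comm]

namespace IsHeatSemigroup

variable {P : ℝ → (Lp ℝ 2 μ →L[ℝ] Lp ℝ 2 μ)}

theorem inner_mulLp_le [IsLocallyFiniteMeasure μ] (hP : IsHeatSemigroup μ L P)
    (h : IsSubRiemannianOperator μ L)
    {φ : SmoothFn n M} {B c : ℝ} (hc : 0 ≤ c) (hB : ∀ x, φ x ^ 2 ≤ B)
    (hφ : ∀ᵐ x ∂μ, carreDuChamp L φ φ x ≤ c * φ x ^ 2) (hη : MemLp (fun x => φ x ^ 2) ∞ μ)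
    (u : Lp ℝ 2 μ) {t : ℝ} (ht : 0 ≤ t) :
    inner ℝ (mulLp hη (P t u)) (P t u) ≤ Real.exp (2 * c * t) * inner ℝ (mulLp hη u) u := by
  refine inner_semigroup_le hP.zero hP.add hP.continuous (inner_mulLp_comm hη)
    (fun v g hv => h.inner_mulLp_le_of_friedrichsGraph hc hB hφ hη ((hP.generator v g).1 hv))
    ((dense_smoothCompactLp (n := n) (μ := μ)).mono ?_) u ht
  rintro _ ⟨φ, hφ, rfl⟩
  exact ⟨_, (hP.generator _ _).2 (h.friedrichsGraph_toLp hφ)⟩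

end IsHeatSemigroup

end HeatSemigroup

/-! ### Smooth functions of gradient at most one that separate compact sets. -/

section Separation

variable {n : ℕ} {M : Type*} [TopologicalSpace M] [ChartedSpace (EuclideanSpace ℝ (Fin n)) M]
  [MeasurableSpace M] {μ : Measure M} {L : SmoothFn n M →ₗ[ℝ] SmoothFn n M}

/-- `f` has gradient at most one for the carré du champ of `L`, almost everywhere. -/
def HasUnitGradient (μ : Measure M) (L : SmoothFn n M →ₗ[ℝ] SmoothFn n M) (f : SmoothFn n M) :
    Prop :=
  ∀ᵐ z ∂μ, carreDuChamp L f f z ≤ 1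

namespace HasUnitGradient

theorem neg {f : SmoothFn n M} (hf : HasUnitGradient μ L f) :
    HasUnitGradient μ L ((-1 : ℝ) • f) := by
  filter_upwards [hf] with x hx
  rw [carreDuChamp_smul_left, carreDuChamp_smul_right]
  simpa using hx

theorem add_const (h1 : L 1 = 0) {f : SmoothFn n M} (hf : HasUnitGradient μ L f) (c : ℝ) :
    HasUnitGradient μ L (f + c • (1 : SmoothFn n M)) := by
  filter_upwards [hf] with x hx
  rw [carreDuChamp_add_left, carreDuChamp_add_right, carreDuChamp_const_left h1,
    carreDuChamp_comm f (c • (1 : SmoothFn n M)), carreDuChamp_const_left h1]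
  simpa using hx

theorem const (h1 : L 1 = 0) (c : ℝ) : HasUnitGradient μ L (c • (1 : SmoothFn n M)) := by
  refine Eventually.of_forall fun x => ?_
  rw [carreDuChamp_const_left h1]
  exact zero_le_one

end HasUnitGradient

/-- A near-optimal competitor for `d(x,y)`, with its sign chosen and a constant added so that the
slack over `r` is shared equally between the two ends. -/
theorem exists_hasUnitGradient_separating_points (h1 : L 1 = 0) {x y : M} {r : ℝ} (hr : 0 ≤ r)
    (hxy : ENNReal.ofReal r < canonicalDist μ L x y) :
    ∃ h : SmoothFn n M, HasUnitGradient μ L h ∧ h x < 0 ∧ r < h y := by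
  obtain ⟨f, hf⟩ := lt_iSup_iff.1 hxy
  obtain ⟨hf1, hf2⟩ := lt_iSup_iff.1 hf
  have hfu : HasUnitGradient μ L f := hf1.mono fun z hz => (le_abs_self _).trans hz
  have hlt := (ENNReal.ofReal_lt_ofReal_iff_of_nonneg hr).1 hf2
  obtain ⟨k, hk, hkr⟩ : ∃ k : SmoothFn n M, HasUnitGradient μ L k ∧ r < k y - k x := by
    rcases lt_abs.1 hlt with h | h
    · refine ⟨_, hfu.neg, ?_⟩
      simp only [ContMDiffMap.coe_smul, Pi.smul_apply, smul_eq_mul]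
      linarith
    · exact ⟨f, hfu, by linarith⟩
  refine ⟨_, hk.add_const h1 (-k x - (k y - k x - r) / 2), ?_, ?_⟩ <;>
  · simp only [ContMDiffMap.coe_add, ContMDiffMap.coe_smul, ContMDiffMap.coe_one, Pi.add_apply,
      Pi.smul_apply, Pi.one_apply, smul_eq_mul, mul_one]
    linarith

variable [IsManifold (𝓡 n) ∞ M]

namespace HasUnitGradient

theorem exists_smooth_max (hL : IsDiffusionOperator L) (h1 : L 1 = 0) {f g : SmoothFn n M}
    (hf : HasUnitGradient μ L f) (hg : HasUnitGradient μ L g) {δ : ℝ} (hδ : 0 < δ) :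
    ∃ h : SmoothFn n M, HasUnitGradient μ L h ∧
      ∀ x, f x ≤ h x ∧ g x ≤ h x ∧ h x ≤ max (f x) (g x) + δ := by
  -- The sum of two exponentials is at most twice the larger, so the soft maximum overshoots by at
  -- most `log 2 / s = δ`.
  obtain ⟨s, hs, hsδ⟩ : ∃ s : ℝ, 0 < s ∧ s * δ = Real.log 2 :=
    ⟨Real.log 2 / δ, div_pos (Real.log_pos one_lt_two) hδ, by field_simp⟩
  have hexp (k : SmoothFn n M) : ∃ K : SmoothFn n M, ∀ x, K x = Real.exp (s * k x) :=
    ⟨⟨fun x => Real.exp (s * k x), (show ContDiff ℝ ∞ fun y : ℝ => Real.exp (s * y) by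
      fun_prop).comp_contMDiff k.contMDiff⟩, fun x => rfl⟩
  obtain ⟨a, ha⟩ := hexp f
  obtain ⟨b, hb⟩ := hexp g
  have hpos (x : M) : 0 < (a + b : SmoothFn n M) x := by
    rw [ContMDiffMap.coe_add, Pi.add_apply, ha, hb]
    positivity
  let h : SmoothFn n M := ⟨fun x => s⁻¹ * Real.log ((a + b : SmoothFn n M) x), fun x => by
    have : ContDiffAt ℝ ∞ (fun y : ℝ => s⁻¹ * Real.log y) ((a + b : SmoothFn n M) x) :=
      contDiffAt_const.mul (Real.contDiffAt_log.2 (hpos x).ne')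
    exact this.comp_contMDiffAt (a + b).contMDiff.contMDiffAt⟩
  have hh (x : M) : h x = s⁻¹ * Real.log ((a + b : SmoothFn n M) x) := rfl
  have hle (x : M) {y : ℝ} (hy : Real.exp (s * y) ≤ (a + b : SmoothFn n M) x) : y ≤ h x := by
    rw [hh, le_inv_mul_iff₀ hs]
    exact (Real.le_log_iff_exp_le (hpos x)).2 hy
  refine ⟨h, ?_, fun x => ⟨hle x ?_, hle x ?_, ?_⟩⟩
  · filter_upwards [hf, hg] with x hfx hgx
    have hlog : HasDerivAt (fun y => s⁻¹ * Real.log y) (s⁻¹ * ((a + b : SmoothFn n M) x)⁻¹)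
        ((a + b : SmoothFn n M) x) := (Real.hasDerivAt_log (hpos x).ne').const_mul _
    have hex (y : ℝ) : HasDerivAt (fun y => Real.exp (s * y)) (Real.exp (s * y) * s) y := by
      simpa using ((hasDerivAt_id y).const_mul s).exp
    have e1 (k : SmoothFn n M) := hL.carreDuChamp_comp_left h1 hh hlog k
    have e2 (k : SmoothFn n M) := hL.carreDuChamp_comp_left h1 ha (hex (f x)) k
    have e3 (k : SmoothFn n M) := hL.carreDuChamp_comp_left h1 hb (hex (g x)) k
    have hx0 := hpos x
    rw [← ha] at e2
    rw [← hb] at e3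
    have hfg : 2 * carreDuChamp L f g x ≤ carreDuChamp L f f x + carreDuChamp L g g x := by
      have h3 := hL.carreDuChamp_self_nonneg h1 (f + (-1 : ℝ) • g) x
      simp only [carreDuChamp_add_left, carreDuChamp_add_right, carreDuChamp_smul_left,
        carreDuChamp_smul_right, carreDuChamp_comm g f, ContMDiffMap.coe_add,
        ContMDiffMap.coe_smul, Pi.add_apply, Pi.smul_apply, smul_eq_mul] at h3
      linarith
    have ha0 : 0 < a x := by rw [ha]; positivity
    have hb0 : 0 < b x := by rw [hb]; positivity
    have e4 : carreDuChamp L (a + b) (a + b) x = s ^ 2 * (a x ^ 2 * carreDuChamp L f f x +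
        2 * (a x * b x) * carreDuChamp L f g x + b x ^ 2 * carreDuChamp L g g x) := by
      simp only [carreDuChamp_add_left, carreDuChamp_add_right, ContMDiffMap.coe_add,
        Pi.add_apply, e2, e3, carreDuChamp_comm f a, carreDuChamp_comm f b,
        carreDuChamp_comm g a, carreDuChamp_comm g b, carreDuChamp_comm g f]
      ring
    have e5 : a x ^ 2 * carreDuChamp L f f x + 2 * (a x * b x) * carreDuChamp L f g x +
        b x ^ 2 * carreDuChamp L g g x ≤ (a x + b x) ^ 2 := by
      have := mul_pos ha0 hb0
      nlinarith [sq_nonneg (a x), sq_nonneg (b x)]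
    rw [e1, carreDuChamp_comm, e1, e4]
    rw [ContMDiffMap.coe_add, Pi.add_apply] at hx0 ⊢
    calc _ = (a x ^ 2 * carreDuChamp L f f x + 2 * (a x * b x) * carreDuChamp L f g x +
        b x ^ 2 * carreDuChamp L g g x) / (a x + b x) ^ 2 := by field_simp
      _ ≤ 1 := (div_le_one (by positivity)).2 e5
  · rw [ContMDiffMap.coe_add, Pi.add_apply, ha, hb]
    linarith [Real.exp_pos (s * g x)]
  · rw [ContMDiffMap.coe_add, Pi.add_apply, ha, hb]
    linarith [Real.exp_pos (s * f x)]
  · rw [hh, inv_mul_le_iff₀ hs, Real.log_le_iff_le_exp (hpos x), mul_add, hsδ, Real.exp_add,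
      Real.exp_log two_pos, ContMDiffMap.coe_add, Pi.add_apply, ha, hb]
    have h2 : Real.exp (s * f x) ≤ Real.exp (s * max (f x) (g x)) := by
      gcongr; exact le_max_left _ _
    have h3 : Real.exp (s * g x) ≤ Real.exp (s * max (f x) (g x)) := by
      gcongr; exact le_max_right _ _
    linarith

theorem exists_smooth_min (hL : IsDiffusionOperator L) (h1 : L 1 = 0) {f g : SmoothFn n M}
    (hf : HasUnitGradient μ L f) (hg : HasUnitGradient μ L g) {δ : ℝ} (hδ : 0 < δ) :
    ∃ h : SmoothFn n M, HasUnitGradient μ L h ∧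
      ∀ x, h x ≤ f x ∧ h x ≤ g x ∧ min (f x) (g x) - δ ≤ h x := by
  obtain ⟨h, hh, hx⟩ := exists_smooth_max hL h1 hf.neg hg.neg hδ
  refine ⟨_, hh.neg, fun x => ?_⟩
  obtain ⟨h2, h3, h4⟩ := hx x
  simp only [ContMDiffMap.coe_smul, Pi.smul_apply, smul_eq_mul, neg_mul, one_mul,
    max_neg_neg] at h2 h3 h4 ⊢
  exact ⟨by linarith, by linarith, by linarith⟩

end HasUnitGradient

theorem exists_hasUnitGradient_separating_point_compact (hL : IsDiffusionOperator L)
    (h1 : L 1 = 0) {x : M} {F : Set M} (hF : IsCompact F) {r : ℝ} (hr : 0 ≤ r)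
    (hxF : ∀ y ∈ F, ENNReal.ofReal r < canonicalDist μ L x y) :
    ∃ h : SmoothFn n M, HasUnitGradient μ L h ∧ h x < 0 ∧ ∀ y ∈ F, r < h y := by
  refine hF.induction_on (p := fun S => ∃ h : SmoothFn n M, HasUnitGradient μ L h ∧ h x < 0 ∧
    ∀ y ∈ S, r < h y) ?_ ?_ ?_ ?_
  · exact ⟨_, HasUnitGradient.const h1 (-1), by simp, by simp⟩
  · rintro S T hST ⟨h, hu, hx, hT⟩
    exact ⟨h, hu, hx, fun y hy => hT y (hST hy)⟩
  · rintro S T ⟨h, hu, hx, hS⟩ ⟨k, ku, kx, hT⟩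
    obtain ⟨m, mu, hm⟩ := hu.exists_smooth_max hL h1 ku
      (half_pos (neg_pos.2 (max_lt hx kx)))
    refine ⟨m, mu, ?_, fun y hy => ?_⟩
    · linarith [(hm x).2.2, max_lt hx kx]
    · rcases hy with hy | hy
      · exact (hS y hy).trans_le (hm y).1
      · exact (hT y hy).trans_le (hm y).2.1
  · intro y hy
    obtain ⟨h, hu, hx, hry⟩ := exists_hasUnitGradient_separating_points h1 hr (hxF y hy)
    exact ⟨{z | r < h z}, mem_nhdsWithin_of_mem_nhds
      ((isOpen_lt continuous_const h.contMDiff.continuous).mem_nhds hry), h, hu, hx,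
      fun z hz => hz⟩

/-- Compactness of `F` was used for each point of `E`; compactness of `E` now combines the resulting
functions by smooth minima. Truncation between `0` and `p` then makes the function bounded. -/
theorem exists_hasUnitGradient_separating (hL : IsDiffusionOperator L) (h1 : L 1 = 0)
    {E F : Set M} (hE : IsCompact E) (hF : IsCompact F) {r : ℝ} (hr : 0 ≤ r)
    (hEF : ENNReal.ofReal r < setDist μ L E F) :
    ∃ h : SmoothFn n M, HasUnitGradient μ L h ∧ (∃ B, ∀ x, |h x| ≤ B) ∧ (∀ x ∈ E, h x ≤ 0) ∧
      ∀ y ∈ F, r ≤ h y := by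
  obtain ⟨s, hrs, hs⟩ := ENNReal.lt_iff_exists_real_btwn.1 hEF |>.imp fun s h => h.2
  replace hrs : r < s := ((ENNReal.ofReal_lt_ofReal_iff_of_nonneg hr).1 hrs)
  have hsd (x : M) (hx : x ∈ E) (y : M) (hy : y ∈ F) :
      ENNReal.ofReal s < canonicalDist μ L x y :=
    hs.trans_le ((iInf₂_le x hx).trans (iInf₂_le y hy))
  obtain ⟨q, hrq, hqs⟩ := exists_between hrs
  obtain ⟨h, hu, ⟨p, hqp, hF'⟩, hE'⟩ : ∃ h : SmoothFn n M, HasUnitGradient μ L h ∧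
      (∃ p, q < p ∧ ∀ y ∈ F, p ≤ h y) ∧ ∀ x ∈ E, h x < 0 := by
    refine hE.induction_on (p := fun S => ∃ h : SmoothFn n M, HasUnitGradient μ L h ∧
      (∃ p, q < p ∧ ∀ y ∈ F, p ≤ h y) ∧ ∀ x ∈ S, h x < 0) ?_ ?_ ?_ ?_
    · exact ⟨_, HasUnitGradient.const h1 s, ⟨s, hqs, by simp⟩, by simp⟩
    · rintro S T hST ⟨h, hu, hF, hT⟩
      exact ⟨h, hu, hF, fun y hy => hT y (hST hy)⟩
    · rintro S T ⟨h, hu, ⟨p, hp, hF⟩, hS⟩ ⟨k, ku, ⟨p', hp', hF'⟩, hT⟩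
      -- Each smooth minimum may lose only half of the remaining gap above `q`, so the lower bound
      -- on `F` stays strictly above `q` however many steps are taken.
      have hmin := lt_min hp hp'
      obtain ⟨m, mu, hm⟩ := hu.exists_smooth_min hL h1 ku (half_pos (sub_pos.2 hmin))
      refine ⟨m, mu, ⟨min p p' - (min p p' - q) / 2, by linarith, fun y hy => ?_⟩, fun y hy => ?_⟩
      · exact (sub_le_sub_right (min_le_min (hF y hy) (hF' y hy)) _).trans (hm y).2.2
      · rcases hy with hy | hy
        · exact (hm y).1.trans_lt (hS y hy)
        · exact (hm y).2.1.trans_lt (hT y hy)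
    · intro x hx
      obtain ⟨h, hu, hx0, hF'⟩ := exists_hasUnitGradient_separating_point_compact hL h1 hF
        (hr.trans hrs.le) (hsd x hx)
      exact ⟨{z | h z < 0}, mem_nhdsWithin_of_mem_nhds
        ((isOpen_lt h.contMDiff.continuous continuous_const).mem_nhds hx0), h, hu,
        ⟨s, hqs, fun y hy => (hF' y hy).le⟩, fun z hz => hz⟩
  -- On `E` the truncation at `0` overshoots by at most `δ = (q - r)/2`, which a shift by `-δ`
  -- corrects. On `F` the truncation at `p` and the shift lose `2δ = q - r` in all, leaving `p - (q
  -- - r) ≥ r`.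
  have hδ : 0 < (q - r) / 2 := by linarith
  obtain ⟨k, ku, hk⟩ := hu.exists_smooth_max hL h1 (HasUnitGradient.const h1 0) hδ
  obtain ⟨m, mu, hm⟩ := ku.exists_smooth_min hL h1 (HasUnitGradient.const h1 p) hδ
  simp only [ContMDiffMap.coe_smul, ContMDiffMap.coe_one, Pi.smul_apply, Pi.one_apply,
    smul_eq_mul, mul_one] at hk hm
  refine ⟨_, mu.add_const h1 (-((q - r) / 2)), ⟨p + (q - r), fun x => ?_⟩, fun x hx => ?_,
    fun y hy => ?_⟩ <;>
  simp only [ContMDiffMap.coe_add, ContMDiffMap.coe_smul, ContMDiffMap.coe_one, Pi.add_apply,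
    Pi.smul_apply, Pi.one_apply, smul_eq_mul, mul_one]
  · have h2 : 0 ≤ min (k x) p := le_min (hk x).2.1 (by linarith)
    rw [abs_le]
    constructor <;> linarith [(hm x).2.1, (hm x).2.2]
  · have h2 : max (h x) 0 ≤ 0 := max_le (hE' x hx).le le_rfl
    linarith [(hm x).1, (hk x).2.2]
  · have h2 : p ≤ min (k y) p := le_min ((hF' y hy).trans (hk y).1) le_rfl
    linarith [(hm y).2.2]

end Separation

/-! ### Restriction to a measurable set as a projection of `L²`. -/

section RestrictLp

variable {M : Type*} [MeasurableSpace M] {μ : Measure M}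

/-- Multiplication by the indicator function of a measurable set, as an operator on `L²`. -/
noncomputable def restrictLp (μ : Measure M) {S : Set M} (hS : MeasurableSet S) :
    Lp ℝ 2 μ →L[ℝ] Lp ℝ 2 μ :=
  mulLp (μ := μ) (η := S.indicator fun _ => 1)
    (memLp_top_of_bound ((measurable_const.indicator hS).aestronglyMeasurable) 1
      (Eventually.of_forall fun x => by by_cases hx : x ∈ S <;> simp [hx]))

variable {S T : Set M}

theorem coeFn_restrictLp (hS : MeasurableSet S) (u : Lp ℝ 2 μ) :
    restrictLp μ hS u =ᵐ[μ] S.indicator u := by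
  filter_upwards [coeFn_mulLp (μ := μ) (η := S.indicator fun _ => 1)
    (memLp_top_of_bound ((measurable_const.indicator hS).aestronglyMeasurable) 1
      (Eventually.of_forall fun x => by by_cases hx : x ∈ S <;> simp [hx])) u] with x hx
  refine hx.trans ?_
  by_cases hxS : x ∈ S <;> simp [hxS]

theorem restrictLp_eq_self (hS : MeasurableSet S) {u : Lp ℝ 2 μ}
    (hu : ∀ᵐ x ∂μ, x ∉ S → u x = 0) : restrictLp μ hS u = u := by
  refine Lp.ext ?_
  filter_upwards [coeFn_restrictLp hS u, hu] with x hx hx'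
  rw [hx]
  by_cases hxS : x ∈ S
  · simp [hxS]
  · simp [hxS, hx' hxS]

theorem inner_restrictLp_comm (hS : MeasurableSet S) (u v : Lp ℝ 2 μ) :
    inner ℝ (restrictLp μ hS u) v = inner ℝ u (restrictLp μ hS v) :=
  inner_mulLp_comm _ u v

theorem enorm_restrictLp (hS : MeasurableSet S) (u : Lp ℝ 2 μ) :
    ‖restrictLp μ hS u‖ₑ = eLpNorm u 2 (μ.restrict S) := by
  rw [Lp.enorm_def, eLpNorm_congr_ae (coeFn_restrictLp hS u),
    eLpNorm_indicator_eq_eLpNorm_restrict hS]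

theorem norm_sq_eq_integral (u : Lp ℝ 2 μ) : ‖u‖ ^ 2 = ∫ x, u x ^ 2 ∂μ := by
  rw [← real_inner_self_eq_norm_sq, L2.inner_def]
  exact integral_congr_ae (Eventually.of_forall fun x => by simp [sq])

theorem norm_restrictLp_sq (hS : MeasurableSet S) (u : Lp ℝ 2 μ) :
    ‖restrictLp μ hS u‖ ^ 2 = ∫ x in S, u x ^ 2 ∂μ := by
  rw [norm_sq_eq_integral, ← integral_indicator hS]
  refine integral_congr_ae ?_
  filter_upwards [coeFn_restrictLp hS u] with x hx
  rw [hx]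
  by_cases hxS : x ∈ S <;> simp [hxS]

theorem norm_restrictLp_le (hS : MeasurableSet S) (u : Lp ℝ 2 μ) : ‖restrictLp μ hS u‖ ≤ ‖u‖ := by
  refine (pow_le_pow_iff_left₀ (norm_nonneg _) (norm_nonneg _) two_ne_zero).1 ?_
  rw [norm_restrictLp_sq, norm_sq_eq_integral]
  exact setIntegral_le_integral (Lp.memLp u).integrable_sq
    (Eventually.of_forall fun x => sq_nonneg _)

/-- Strong convergence of the projections: the squared error is the integral of `u²` over `T` minus
that over `S k`. -/
theorem tendsto_restrictLp {S : ℕ → Set M} (hS : ∀ k, MeasurableSet (S k)) (hmono : Monotone S)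
    (hT : MeasurableSet T) (hST : ⋃ k, S k = T) (u : Lp ℝ 2 μ) :
    Tendsto (fun k => restrictLp μ (hS k) u) atTop (𝓝 (restrictLp μ hT u)) := by
  rw [tendsto_iff_norm_sub_tendsto_zero]
  have hsq (k : ℕ) : ‖restrictLp μ (hS k) u - restrictLp μ hT u‖ ^ 2 =
      ∫ x in T, u x ^ 2 ∂μ - ∫ x in S k, u x ^ 2 ∂μ := by
    have hsub : S k ⊆ T := hST ▸ subset_iUnion S k
    have hi := (Lp.memLp u).integrable_sq
    rw [norm_sq_eq_integral, ← integral_indicator hT, ← integral_indicator (hS k),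
      ← integral_sub (hi.indicator hT) (hi.indicator (hS k))]
    refine integral_congr_ae ?_
    filter_upwards [coeFn_restrictLp hT u, coeFn_restrictLp (hS k) u,
      Lp.coeFn_sub (restrictLp μ (hS k) u) (restrictLp μ hT u)] with x h1 h2 h3
    rw [h3, Pi.sub_apply, h1, h2]
    by_cases hxS : x ∈ S k
    · simp [hxS, hsub hxS]
    · by_cases hxT : x ∈ T <;> simp [hxS, hxT]
  have hlim : Tendsto (fun k => ∫ x in S k, u x ^ 2 ∂μ) atTop (𝓝 (∫ x in T, u x ^ 2 ∂μ)) := by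
    rw [← hST]
    exact tendsto_setIntegral_of_monotone hS hmono (Lp.memLp u).integrable_sq.integrableOn
  have h0 := (hlim.const_sub (∫ x in T, u x ^ 2 ∂μ)).congr fun k => (hsq k).symm
  rw [sub_self] at h0
  simpa using h0.sqrt

end RestrictLp

/-! ### The Davies–Gaffney estimate on `L²`: compact sets, then closed sets. -/

section DaviesGaffney

variable {n : ℕ} {M : Type*} [TopologicalSpace M] [ChartedSpace (EuclideanSpace ℝ (Fin n)) M]
  [MeasurableSpace M] {μ : Measure M} {L : SmoothFn n M →ₗ[ℝ] SmoothFn n M}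

theorem canonicalDist_comm (x y : M) : canonicalDist μ L x y = canonicalDist μ L y x := by
  simp only [canonicalDist, abs_sub_comm]

theorem setDist_comm (E F : Set M) : setDist μ L E F = setDist μ L F E := by
  simp only [setDist]
  rw [iInf₂_comm]
  simp only [canonicalDist_comm]

theorem setDist_anti {E E' F F' : Set M} (hE : E ⊆ E') (hF : F ⊆ F') :
    setDist μ L E' F' ≤ setDist μ L E F :=
  le_iInf₂ fun x hx => le_iInf₂ fun y hy => (iInf₂_le x (hE hx)).trans (iInf₂_le y (hF hy))

variable [BorelSpace M] [IsManifold (𝓡 n) ∞ M] [T2Space M] [SecondCountableTopology M]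
  [IsLocallyFiniteMeasure μ] {P : ℝ → (Lp ℝ 2 μ →L[ℝ] Lp ℝ 2 μ)} {E F : Set M}

namespace IsHeatSemigroup

theorem norm_restrictLp_le_of_isCompact (hP : IsHeatSemigroup μ L P)
    (h : IsSubRiemannianOperator μ L) (hE : IsCompact E) (hF : IsCompact F) {r : ℝ} (hr : 0 ≤ r)
    (hEF : ENNReal.ofReal r < setDist μ L E F) {t : ℝ} (ht : 0 < t) (u : Lp ℝ 2 μ) :
    ‖restrictLp μ hF.measurableSet (P t (restrictLp μ hE.measurableSet u))‖ ≤
      Real.exp (-(r ^ 2 / (4 * t))) * ‖restrictLp μ hE.measurableSet u‖ := by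
  obtain ⟨ψ, hψ, ⟨B, hB⟩, hψE, hψF⟩ :=
    exists_hasUnitGradient_separating h.diffusion h.map_one hE hF hr hEF
  set v := restrictLp μ hE.measurableSet u
  -- This minimises `2a²t - 2ar`, with minimum `-r²/(2t)`; the final square root halves the
  -- exponent.
  set a : ℝ := r / (2 * t)
  have ha : 0 ≤ a := by positivity
  let φ : SmoothFn n M := ⟨fun x => Real.exp (a * ψ x), (show ContDiff ℝ ∞ fun y : ℝ =>
    Real.exp (a * y) by fun_prop).comp_contMDiff ψ.contMDiff⟩
  have hφ (x : M) : φ x = Real.exp (a * ψ x) := rfl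
  have hφsq (x : M) : φ x ^ 2 = Real.exp (2 * a * ψ x) := by
    rw [hφ, sq, ← Real.exp_add]
    congr 1
    ring
  have hφB (x : M) : φ x ^ 2 ≤ Real.exp (2 * a * B) := by
    rw [hφsq]
    gcongr
    exact (le_abs_self _).trans (hB x)
  have hΓ : ∀ᵐ x ∂μ, carreDuChamp L φ φ x ≤ a ^ 2 * φ x ^ 2 := by
    filter_upwards [hψ] with x hx
    have hex : HasDerivAt (fun y => Real.exp (a * y)) (Real.exp (a * ψ x) * a) (ψ x) := by
      simpa using ((hasDerivAt_id (ψ x)).const_mul a).exp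
    have e (k : SmoothFn n M) := h.diffusion.carreDuChamp_comp_left h.map_one hφ hex k
    rw [e, carreDuChamp_comm, e, ← hφ]
    have := mul_le_mul_of_nonneg_left hx (sq_nonneg (φ x * a))
    linarith
  have hη : MemLp (fun x => φ x ^ 2) ∞ μ :=
    memLp_top_of_bound (φ.contMDiff.continuous.pow 2).aestronglyMeasurable
      (Real.exp (2 * a * B)) (Eventually.of_forall fun x => by
        rw [Real.norm_of_nonneg (sq_nonneg _)]
        exact hφB x)
  have hint (w : Lp ℝ 2 μ) : Integrable (fun x => φ x ^ 2 * w x * w x) μ := by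
    refine (L2.integrable_inner (𝕜 := ℝ) (mulLp hη w) w).congr ?_
    filter_upwards [coeFn_mulLp hη w] with x hx
    rw [hx]
    simp [mul_comm]
  have key := hP.inner_mulLp_le h (sq_nonneg a) hφB hΓ hη v ht.le
  rw [inner_mulLp, inner_mulLp] at key
  have hright : ∫ x, φ x ^ 2 * v x * v x ∂μ ≤ ‖v‖ ^ 2 := by
    rw [norm_sq_eq_integral]
    refine integral_mono_ae (hint v) (Lp.memLp v).integrable_sq ?_
    filter_upwards [coeFn_restrictLp hE.measurableSet u] with x hx
    by_cases hxE : x ∈ E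
    · have h1 : φ x ^ 2 ≤ 1 := by
        rw [hφsq, Real.exp_le_one_iff]
        exact mul_nonpos_of_nonneg_of_nonpos (by positivity) (hψE x hxE)
      have h2 := mul_le_mul_of_nonneg_right h1 (sq_nonneg (v x))
      linarith
    · have : v x = 0 := by rw [hx]; simp [hxE]
      simp [this]
  have hleft : Real.exp (2 * a * r) * ‖restrictLp μ hF.measurableSet (P t v)‖ ^ 2 ≤
      ∫ x, φ x ^ 2 * P t v x * P t v x ∂μ := by
    rw [norm_restrictLp_sq, ← integral_const_mul]
    refine le_trans ?_ (setIntegral_le_integral (s := F) (hint (P t v))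
      (Eventually.of_forall fun x => ?_))
    · refine setIntegral_mono_on ((Lp.memLp (P t v)).integrable_sq.const_mul _).integrableOn
        (hint _).integrableOn hF.measurableSet fun x hx => ?_
      have h1 : Real.exp (2 * a * r) ≤ φ x ^ 2 := by
        rw [hφsq]
        gcongr
        exact hψF x hx
      have h2 := mul_le_mul_of_nonneg_right h1 (sq_nonneg (P t v x))
      linarith
    · have := mul_nonneg (sq_nonneg (φ x)) (sq_nonneg (P t v x))
      simp only [Pi.zero_apply]
      linarith
  refine (pow_le_pow_iff_left₀ (norm_nonneg _) (by positivity) two_ne_zero).1 ?_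
  have hfin : Real.exp (2 * a * r) * ‖restrictLp μ hF.measurableSet (P t v)‖ ^ 2 ≤
      Real.exp (2 * a ^ 2 * t) * ‖v‖ ^ 2 :=
    hleft.trans (key.trans (by gcongr))
  rw [← le_div_iff₀' (Real.exp_pos _)] at hfin
  refine hfin.trans_eq ?_
  rw [mul_pow, ← Real.exp_nat_mul, mul_div_right_comm, ← Real.exp_sub]
  congr 2
  simp only [a]
  push_cast
  field_simp
  ring

theorem norm_restrictLp_le_of_lt (hP : IsHeatSemigroup μ L P)
    (h : IsSubRiemannianOperator μ L) (hE : IsClosed E) (hF : IsClosed F) {r : ℝ} (hr : 0 ≤ r)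
    (hEF : ENNReal.ofReal r < setDist μ L E F) {t : ℝ} (ht : 0 < t) (u : Lp ℝ 2 μ) :
    ‖restrictLp μ hF.measurableSet (P t (restrictLp μ hE.measurableSet u))‖ ≤
      Real.exp (-(r ^ 2 / (4 * t))) * ‖restrictLp μ hE.measurableSet u‖ := by
  have : LocallyCompactSpace M := Manifold.locallyCompact_of_finiteDimensional (𝓡 n)
  have hcE (k : ℕ) : IsCompact (E ∩ compactCovering M k) :=
    (isCompact_compactCovering M k).inter_left hE
  have hcF (k : ℕ) : IsCompact (F ∩ compactCovering M k) :=
    (isCompact_compactCovering M k).inter_left hF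
  have hmono (S : Set M) : Monotone fun k => S ∩ compactCovering M k :=
    fun i j hij => inter_subset_inter_right _ (compactCovering_subset M hij)
  have hunion (S : Set M) : ⋃ k, S ∩ compactCovering M k = S := by
    rw [← inter_iUnion, iUnion_compactCovering, inter_univ]
  have hlimE := tendsto_restrictLp (μ := μ) (fun k => (hcE k).measurableSet) (hmono E)
    hE.measurableSet (hunion E) u
  have hlimF := tendsto_restrictLp (μ := μ) (fun k => (hcF k).measurableSet) (hmono F)
    hF.measurableSet (hunion F) (P t (restrictLp μ hE.measurableSet u))
  refine le_of_tendsto hlimF.norm (Eventually.of_forall fun j => ?_)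
  refine le_of_tendsto_of_tendsto
    ((((restrictLp μ (hcF j).measurableSet).comp (P t)).continuous.tendsto _).comp hlimE).norm
    (hlimE.norm.const_mul _) (Eventually.of_forall fun k => ?_)
  exact hP.norm_restrictLp_le_of_isCompact h (hcE k) (hcF j) hr
    (hEF.trans_le (setDist_anti inter_subset_left inter_subset_left)) ht u

/-- The Davies–Gaffney estimate on `L²`. -/
theorem norm_restrictLp_le (hP : IsHeatSemigroup μ L P)
    (h : IsSubRiemannianOperator μ L) (hE : IsClosed E) (hF : IsClosed F)
    {t : ℝ} (ht : 0 < t) (u : Lp ℝ 2 μ) :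
    ‖restrictLp μ hF.measurableSet (P t (restrictLp μ hE.measurableSet u))‖ ≤
      Real.exp (-((setDist μ L E F).toReal ^ 2 / (4 * t))) *
        ‖restrictLp μ hE.measurableSet u‖ := by
  -- Distance `⊤`, as for an empty set, has `toReal` equal to `0` and falls in the first case, where
  -- contraction suffices. Otherwise `r` increases to the distance.
  rcases (ENNReal.toReal_nonneg (a := setDist μ L E F)).eq_or_lt' with h0 | h0
  · rw [h0]
    simpa using (_root_.norm_restrictLp_le hF.measurableSet _).trans (hP.contraction t ht.le _)
  · have hlim : Tendsto (fun r : ℝ => Real.exp (-(r ^ 2 / (4 * t))) *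
        ‖restrictLp μ hE.measurableSet u‖) (𝓝[<] (setDist μ L E F).toReal)
        (𝓝 (Real.exp (-((setDist μ L E F).toReal ^ 2 / (4 * t))) *
          ‖restrictLp μ hE.measurableSet u‖)) :=
      (Continuous.tendsto (by fun_prop) _).mono_left nhdsWithin_le_nhds
    refine ge_of_tendsto hlim ?_
    filter_upwards [Ioo_mem_nhdsLT h0] with r hr
    refine hP.norm_restrictLp_le_of_lt h hE hF hr.1.le ?_ ht u
    exact ((ENNReal.ofReal_lt_ofReal_iff h0).2 hr.2).trans_le ENNReal.ofReal_toReal_le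

end IsHeatSemigroup

end DaviesGaffney

/-! ### Evolution by the adjoint, reached by duality. -/

section HeatEvolution

variable {n : ℕ} {M : Type*} [TopologicalSpace M] [ChartedSpace (EuclideanSpace ℝ (Fin n)) M]
  [MeasurableSpace M] {μ : Measure M} {L : SmoothFn n M →ₗ[ℝ] SmoothFn n M}
  [BorelSpace M] [IsManifold (𝓡 n) ∞ M] [T2Space M] [SecondCountableTopology M]
  [IsLocallyFiniteMeasure μ] {P : ℝ → (Lp ℝ 2 μ →L[ℝ] Lp ℝ 2 μ)} {E F : Set M}

namespace IsHeatSemigroup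

/-- Test the adjoint relation against `g = 1_{F ∩ K} u`, which is in `L¹ ∩ L²` because `u` is
bounded and `K` compact. Then `‖g‖² = ⟨f, 1_E P_t g⟩`, and the `L²` estimate with `E` and `F`
exchanged gives `‖g‖² ≤ C ‖f‖ ‖g‖`. -/
theorem eLpNorm_indicator_le_of_adjoint (hP : IsHeatSemigroup μ L P)
    (h : IsSubRiemannianOperator μ L) (hE : IsClosed E) (hF : IsClosed F)
    {t : ℝ} (ht : 0 < t) {f u : M → ℝ} (hf : MemLp f 2 μ)
    (hfE : ∀ᵐ x ∂μ, x ∉ E → f x = 0) (hu : MemLp u ∞ μ)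
    (hadj : ∀ (g : M → ℝ) (hg : MemLp g 2 μ), Integrable g μ →
      ∫ x, u x * g x ∂μ = ∫ x, f x * P t (hg.toLp g) x ∂μ) {K : Set M} (hK : IsCompact K) :
    eLpNorm ((F ∩ K).indicator u) 2 μ ≤
      ENNReal.ofReal (Real.exp (-((setDist μ L E F).toReal ^ 2 / (4 * t)))) *
        eLpNorm f 2 μ := by
  have hS : MeasurableSet (F ∩ K) := hF.measurableSet.inter hK.measurableSet
  have hSfin : μ (F ∩ K) ≠ ⊤ := ((measure_mono inter_subset_right).trans_lt hK.measure_lt_top).ne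
  have hmem (p : ℝ≥0∞) : MemLp ((F ∩ K).indicator u) p μ :=
    (hu.indicator hS).mono_exponent_of_measure_support_ne_top
      (fun x hx => indicator_of_notMem hx _) hSfin le_top
  have hadj' := hadj _ (hmem 2) (memLp_one_iff_integrable.1 (hmem 1))
  set g : Lp ℝ 2 μ := (hmem 2).toLp _
  set v : Lp ℝ 2 μ := hf.toLp f
  have hv : restrictLp μ hE.measurableSet v = v := by
    refine restrictLp_eq_self _ ?_
    filter_upwards [hf.coeFn_toLp, hfE] with x hx hx'
    rwa [hx]
  have hg : restrictLp μ hF.measurableSet g = g := by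
    refine restrictLp_eq_self _ ?_
    filter_upwards [(hmem 2).coeFn_toLp] with x hx hx'
    rw [hx, indicator_of_notMem fun h => hx' h.1]
  have hgg : ∫ x, u x * (F ∩ K).indicator u x ∂μ = ‖g‖ ^ 2 := by
    rw [norm_sq_eq_integral]
    refine integral_congr_ae ?_
    filter_upwards [(hmem 2).coeFn_toLp] with x hx
    rw [hx]
    by_cases hxS : x ∈ F ∩ K
    · simp only [indicator_of_mem hxS, sq]
    · simp only [indicator_of_notMem hxS]
      simp
  have hfg : ∫ x, f x * P t g x ∂μ = inner ℝ v (P t g) := by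
    rw [L2.inner_def]
    refine integral_congr_ae ?_
    filter_upwards [hf.coeFn_toLp] with x hx
    simp only [v, hx, RCLike.inner_apply, conj_trivial]
    exact mul_comm _ _
  have hbound := hP.norm_restrictLp_le h hF hE ht g
  rw [hg, setDist_comm] at hbound
  set C := Real.exp (-((setDist μ L E F).toReal ^ 2 / (4 * t)))
  have hsq : ‖g‖ ^ 2 ≤ C * ‖v‖ * ‖g‖ := by
    rw [← hgg, hadj', hfg, ← hv, inner_restrictLp_comm, hv]
    calc _ ≤ ‖v‖ * ‖restrictLp μ hE.measurableSet (P t g)‖ := real_inner_le_norm _ _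
      _ ≤ ‖v‖ * (C * ‖g‖) := by gcongr
      _ = _ := by ring
  have hle : ‖g‖ ≤ C * ‖v‖ := by
    rcases (norm_nonneg g).eq_or_lt' with h0 | h0
    · rw [h0]
      positivity
    · rw [sq] at hsq
      exact le_of_mul_le_mul_right hsq h0
  have h1 := ENNReal.ofReal_le_ofReal hle
  rwa [ENNReal.ofReal_mul (Real.exp_nonneg _), ofReal_norm, ofReal_norm, Lp.enorm_toLp,
    Lp.enorm_toLp] at h1

end IsHeatSemigroup

end HeatEvolution

theorem lemma3p6 {n : ℕ} {M : Type*} [TopologicalSpace M]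
    [ChartedSpace (EuclideanSpace ℝ (Fin n)) M] [IsManifold (𝓡 n) ∞ M]
    [T2Space M] [SecondCountableTopology M] [ConnectedSpace M] [NoncompactSpace M]
    [MeasurableSpace M] [BorelSpace M]
    (μ : Measure M) (hμ : IsSmoothMeasure n μ)
    (L : SmoothFn n M →ₗ[ℝ] SmoothFn n M) (hL : IsSubRiemannianOperator μ L)
    (ΓZ : SmoothFn n M →ₗ[ℝ] SmoothFn n M →ₗ[ℝ] SmoothFn n M) (hΓZ : IsVerticalForm μ L ΓZ)
    (P : ℝ → (Lp ℝ 2 μ →L[ℝ] Lp ℝ 2 μ)) (hP : IsHeatSemigroup μ L P)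
    (E F : Set M) (hE : IsClosed E) (hF : IsClosed F)
    (t : ℝ) (ht : 0 < t)
    (f : M → ℝ) (hf : MemLp f ∞ μ) (hfE : ∀ᵐ x ∂μ, x ∉ E → f x = 0)
    (u : M → ℝ) (hu : IsHeatEvolution μ P t f u) :
    eLpNorm u 2 (μ.restrict F) ≤
      ENNReal.ofReal (Real.exp (-((setDist μ L E F).toReal ^ 2 / (4 * t)))) *
        eLpNorm f 2 (μ.restrict E) := by
  have := hμ.isLocallyFiniteMeasure
  have : LocallyCompactSpace M := Manifold.locallyCompact_of_finiteDimensional (𝓡 n)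
  have hind : E.indicator f =ᵐ[μ] f := by
    filter_upwards [hfE] with x hx
    by_cases hxE : x ∈ E
    · simp [hxE]
    · simp [hxE, hx hxE]
  rw [← eLpNorm_indicator_eq_eLpNorm_restrict hE.measurableSet, eLpNorm_congr_ae hind]
  rcases hu with ⟨hf2, hu⟩ | ⟨-, hu, hadj⟩
  · have hv : restrictLp μ hE.measurableSet (hf2.toLp f) = hf2.toLp f := by
      refine restrictLp_eq_self _ ?_
      filter_upwards [hf2.coeFn_toLp, hfE] with x hx hx'
      rwa [hx]
    have h1 := ENNReal.ofReal_le_ofReal (hP.norm_restrictLp_le hL hE hF ht (hf2.toLp f))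
    rwa [hv, ENNReal.ofReal_mul (Real.exp_nonneg _), ofReal_norm, ofReal_norm, enorm_restrictLp,
      Lp.enorm_toLp, eLpNorm_congr_ae (ae_restrict_of_ae hu.symm)] at h1
  · by_cases hf2 : eLpNorm f 2 μ = ⊤
    · rw [hf2, ENNReal.mul_top (by simp [Real.exp_pos])]
      exact le_top
    · have hf2' : MemLp f 2 μ := ⟨hf.1, lt_top_iff_ne_top.2 hf2⟩
      have hS (k : ℕ) : MeasurableSet (F ∩ compactCovering M k) :=
        hF.measurableSet.inter (isCompact_compactCovering M k).measurableSet
      rw [← eLpNorm_indicator_eq_eLpNorm_restrict hF.measurableSet]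
      -- `u` is not known to be in `L²`, so Fatou's lemma carries the bound, uniform in the compact
      -- set, over to all of `F`.
      refine (Lp.eLpNorm_lim_le_liminf_eLpNorm
        (f := fun k => (F ∩ compactCovering M k).indicator u)
        (fun k => hu.1.indicator (hS k)) _ (Eventually.of_forall fun x => ?_)).trans
        (liminf_le_of_le (by isBoundedDefault) fun b hb => ?_)
      · obtain ⟨N, hN⟩ := exists_mem_compactCovering x
        refine tendsto_const_nhds.congr' ?_
        filter_upwards [eventually_ge_atTop N] with k hk
        by_cases hx : x ∈ F <;> simp [hx, compactCovering_subset M hk hN]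
      · obtain ⟨k, hk⟩ := hb.exists
        exact hk.trans (hP.eLpNorm_indicator_le_of_adjoint hL hE hF ht hf2' hfE hu hadj
          (isCompact_compactCovering M k))
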